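/- Let $\mathbb F$ be a field of characteristic zero. Let $O$ be the Onsager Lie algebra over $\mathbb F$, i.e. the Lie algebra with generators $A,B$ and relations $[A,[A,[A,B]]]=4[A,B]$, $[B,[B,[B,A]]]=4[B,A]$. Let $\boxtimes$ be the tetrahedron algebra, i.e. the Lie algebra over $\mathbb F$ with generators $x_{ij}$ ($i,j\in\{0,1,2,3\}$, $i\neq j$) and relations $x_{ij}+x_{ji}=0$; $[x_{ij},x_{jk}]=2x_{ij}+2x_{jk}$ for mutually distinct $i,j,k$; $[x_{ij},[x_{ij},[x_{ij},x_{kh}]]]=4[x_{ij},x_{kh}]$ for mutually distinct $h,i,j,k$. For distinct $i,j$, an element $\xi\in\boxtimes$ is called $x_{ij}$-like if $[x_{ij},\xi]=0$ and $[x_{kh},[x_{kh},[x_{kh},\xi]]]=4[x_{kh},\xi]$, where $h,i,j,k$ are mutually distinct. In $\mathfrak{sl}_2$ with its usual basis $e,f,h$ let $x=2e-h$, $y=-2f-h$, $z=h$. Let $\mathcal A=\mathbb F[t,t^{-1},(t-1)^{-1}]$ and let $L(\mathfrak{sl}_2)^+=\mathfrak{sl}_2\otimes\mathcal A$, with bracket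 $[u\otimes a,v\otimes b]=[u,v]\otimes ab$ and $\mathcal A$-action $(u\otimes a)b=u\otimes ab$. Put $t'=1-t^{-1}$, $t''=(1-t)^{-1}$. Let $\sigma:\boxtimes\to L(\mathfrak{sl}_2)^+$ be the Lie algebra homomorphism with $x_{12}\mapsto x\otimes1$, $x_{23}\mapsto y\otimes1$, $x_{31}\mapsto z\otimes1$, $x_{03}\mapsto y\otimes t+z\otimes(t-1)$, $x_{01}\mapsto z\otimes t'+x\otimes(t'-1)$, $x_{02}\mapsto x\otimes t''+y\otimes(t''-1)$, let $\kappa:O\to\boxtimes$ be the Lie algebra homomorphism with $A\mapsto x_{12}$, $B\mapsto x_{03}$, and let $\iota=\sigma\circ\kappa:O\to L(\mathfrak{sl}_2)^+$. For $i\in\mathbb N=\{0,1,2,\dots\}$ define in $L(\mathfrak{sl}_2)^+$ $$A_i^{\downarrow\downarrow}=-x\otimes(t-1)^i,\qquad B_i^{\downarrow\downarrow}=(-y\otimes t-z\otimes(t-1))(t-1)^i,\qquad \psi_i^{\downarrow\downarrow}=(-x\otimes1-y\otimes t)(t-1)^{i-1}.$$ Then $\iota$ is injective. Identify $O$ with its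 images in $\boxtimes$ and in $L(\mathfrak{sl}_2)^+$ via $\kappa$ and $\iota$. Then the elements $$A_i^{\downarrow\downarrow},\qquad B_i^{\downarrow\downarrow},\qquad \psi_{i+1}^{\downarrow\downarrow}\qquad(i\in\mathbb N)$$ form a basis of the $\mathbb F$-vector space $O$, with $A_0^{\downarrow\downarrow}=-A$ and $B_0^{\downarrow\downarrow}=-B$. For every $i\in\mathbb N$, regarded as elements of $\boxtimes$, the basis element $A_i^{\downarrow\downarrow}$ is $x_{21}$-like, $B_i^{\downarrow\downarrow}$ is $x_{30}$-like and $\psi_{i+1}^{\downarrow\downarrow}$ is $x_{02}$-like. Moreover, for all $i,j\in\mathbb N$, $$[A_i^{\downarrow\downarrow},A_j^{\downarrow\downarrow}]=0,\qquad [B_i^{\downarrow\downarrow},B_j^{\downarrow\downarrow}]=0,\qquad [\psi_i^{\downarrow\downarrow},\psi_j^{\downarrow\downarrow}]=0,$$ $$[\psi_i^{\downarrow\downarrow},A_j^{\downarrow\downarrow}]=2\psi_{i+j}^{\downarrow\downarrow}+2A_{i+j}^{\downarrow\downarrow},\qquad [B_i^{\downarrow\downarrow},\psi_j^{\downarrow\downarrow}]=2B_{i+j}^{\downarrow\downarrow}+2\psi_{i+j}^{\downarrow\downarrow},$$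 $$[A_i^{\downarrow\downarrow},B_j^{\downarrow\downarrow}]=2A_{i+j}^{\downarrow\downarrow}+2B_{i+j}^{\downarrow\downarrow}-4\psi_{i+j+1}^{\downarrow\downarrow}.$$ -/

import Mathlib

open scoped TensorProduct

noncomputable section

namespace OnsagerTet

/-! ### Lie algebras given by generators and relations -/

/-- The Lie algebra over `F` with generators `X` and relations `r = 0` for `r ∈ rels`. -/
abbrev Presented (F : Type*) [CommRing F] (X : Type*) (rels : Set (FreeLieAlgebra F X)) : Type _ :=
  FreeLieAlgebra F X ⧸ LieSubmodule.lieSpan F (FreeLieAlgebra F X) rels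

namespace Presented

variable {F : Type*} [CommRing F] {X : Type*} {rels : Set (FreeLieAlgebra F X)}

/-- The generator of the presented Lie algebra attached to `a : X`. -/
def gen (rels : Set (FreeLieAlgebra F X)) (a : X) : Presented F X rels :=
  LieSubmodule.Quotient.mk (FreeLieAlgebra.of F a)

/-- A map on the generators that respects the relations extends to a Lie algebra homomorphism. -/
def lift {L : Type*} [LieRing L] [LieAlgebra F L] (f : X → L)
    (hf : ∀ r ∈ rels, FreeLieAlgebra.lift F f r = 0) : Presented F X rels →ₗ⁅F⁆ L :=
  { Submodule.liftQ (LieSubmodule.lieSpan F (FreeLieAlgebra F X) rels).toSubmodule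
      (FreeLieAlgebra.lift F f : FreeLieAlgebra F X →ₗ[F] L)
      (fun a ha => by
        have h : LieSubmodule.lieSpan F (FreeLieAlgebra F X) rels ≤ (FreeLieAlgebra.lift F f).ker :=
          LieSubmodule.lieSpan_le.2 fun r hr => by
            simpa [LieHom.mem_ker] using hf r hr
        have := h ha
        simpa [LieHom.mem_ker] using this) with
    map_lie' := by
      intro a b
      obtain ⟨a, rfl⟩ := LieSubmodule.Quotient.surjective_mk' _ a
      obtain ⟨b, rfl⟩ := LieSubmodule.Quotient.surjective_mk' _ b
      exact LieHom.map_lie (FreeLieAlgebra.lift F f) a b }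

theorem lift_mk {L : Type*} [LieRing L] [LieAlgebra F L] (f : X → L)
    (hf : ∀ r ∈ rels, FreeLieAlgebra.lift F f r = 0) (a : FreeLieAlgebra F X) :
    lift f hf (LieSubmodule.Quotient.mk a) = FreeLieAlgebra.lift F f a := rfl

@[simp]
theorem lift_gen {L : Type*} [LieRing L] [LieAlgebra F L] (f : X → L)
    (hf : ∀ r ∈ rels, FreeLieAlgebra.lift F f r = 0) (a : X) :
    lift f hf (gen rels a) = f a := by
  rw [gen, lift_mk, FreeLieAlgebra.lift_of_apply]

theorem mk_eq_lift_gen (a : FreeLieAlgebra F X) :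
    (LieSubmodule.Quotient.mk a : Presented F X rels) = FreeLieAlgebra.lift F (gen rels) a := by
  let q : FreeLieAlgebra F X →ₗ⁅F⁆ Presented F X rels :=
    { ((LieSubmodule.lieSpan F (FreeLieAlgebra F X) rels).toSubmodule.mkQ) with
      map_lie' := rfl }
  have hq : q = FreeLieAlgebra.lift F (gen rels) := by
    apply FreeLieAlgebra.hom_ext
    intro x
    rw [FreeLieAlgebra.lift_of_apply]
    rfl
  exact congrArg (fun g : FreeLieAlgebra F X →ₗ⁅F⁆ Presented F X rels => g a) hq

/-- The defining relations hold in the presented Lie algebra. -/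
theorem rel {r : FreeLieAlgebra F X} (hr : r ∈ rels) :
    FreeLieAlgebra.lift F (gen rels) r = 0 := by
  rw [← mk_eq_lift_gen]
  exact (LieSubmodule.Quotient.mk_eq_zero').2 (LieSubmodule.subset_lieSpan hr)

end Presented

/-! ### The Onsager Lie algebra and the tetrahedron algebra -/

variable (F : Type*) [Field F]

/-- The two generators `A` (index `0`) and `B` (index `1`) in the free Lie algebra. -/
abbrev freeAB (i : Fin 2) : FreeLieAlgebra F (Fin 2) := FreeLieAlgebra.of F i

/-- The Dolan-Grady relations `[A,[A,[A,B]]] = 4[A,B]` and `[B,[B,[B,A]]] = 4[B,A]`. -/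
inductive OnsagerRel : Set (FreeLieAlgebra F (Fin 2))
  | dg1 : OnsagerRel (⁅freeAB F 0, ⁅freeAB F 0, ⁅freeAB F 0, freeAB F 1⁆⁆⁆
      - (4 : F) • ⁅freeAB F 0, freeAB F 1⁆)
  | dg2 : OnsagerRel (⁅freeAB F 1, ⁅freeAB F 1, ⁅freeAB F 1, freeAB F 0⁆⁆⁆
      - (4 : F) • ⁅freeAB F 1, freeAB F 0⁆)

/-- The Onsager Lie algebra `O`. -/
abbrev Onsager : Type _ := Presented F (Fin 2) (OnsagerRel F)

/-- The standard generator `A` of `O`. -/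
def genA : Onsager F := Presented.gen (OnsagerRel F) 0

/-- The standard generator `B` of `O`. -/
def genB : Onsager F := Presented.gen (OnsagerRel F) 1

/-- Ordered pairs of distinct elements of `{0,1,2,3}`. -/
abbrev Pairs : Type := {p : Fin 4 × Fin 4 // p.1 ≠ p.2}

/-- The generator `x_ij` in the free Lie algebra. -/
abbrev freeX {i j : Fin 4} (h : i ≠ j) : FreeLieAlgebra F Pairs :=
  FreeLieAlgebra.of F ⟨(i, j), h⟩

/-- The defining relations of the tetrahedron algebra. -/
inductive TetRel : Set (FreeLieAlgebra F Pairs)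
  | skew {i j : Fin 4} (hij : i ≠ j) : TetRel (freeX F hij + freeX F hij.symm)
  | triangle {i j k : Fin 4} (hij : i ≠ j) (hjk : j ≠ k) (hik : i ≠ k) :
      TetRel (⁅freeX F hij, freeX F hjk⁆ - ((2 : F) • freeX F hij + (2 : F) • freeX F hjk))
  | dolanGrady {h i j k : Fin 4} (hhi : h ≠ i) (hhj : h ≠ j) (hij : i ≠ j) (hik : i ≠ k)
      (hjk : j ≠ k) (hkh : k ≠ h) :
      TetRel (⁅freeX F hij, ⁅freeX F hij, ⁅freeX F hij, freeX F hkh⁆⁆⁆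
        - (4 : F) • ⁅freeX F hij, freeX F hkh⁆)

/-- The tetrahedron algebra `⊠`. -/
abbrev Tet : Type _ := Presented F Pairs (TetRel F)

/-- The standard generator `x_ij` of `⊠`, for distinct `i`, `j`. -/
def xGen {i j : Fin 4} (h : i ≠ j) : Tet F := Presented.gen (TetRel F) ⟨(i, j), h⟩

variable {F} in
/-- `ξ` is an `x_ij`-like element of `⊠`: it commutes with `x_ij`, and satisfies
`[x_kh,[x_kh,[x_kh,ξ]]] = 4[x_kh,ξ]` where `{h,k}` is the complement of `{i,j}`. -/
def IsLike {i j : Fin 4} (hij : i ≠ j) (ξ : Tet F) : Prop :=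
  ⁅xGen F hij, ξ⁆ = 0 ∧
    ∀ (h k : Fin 4) (hkh : k ≠ h), h ≠ i → h ≠ j → k ≠ i → k ≠ j →
      ⁅xGen F hkh, ⁅xGen F hkh, ⁅xGen F hkh, ξ⁆⁆⁆ = (4 : F) • ⁅xGen F hkh, ξ⁆

/-- The embedding `O → ⊠` with `A ↦ x_12`, `B ↦ x_03`. -/
def onsagerToTet : Onsager F →ₗ⁅F⁆ Tet F :=
  Presented.lift ![xGen F (show (1 : Fin 4) ≠ 2 by decide),
      xGen F (show (0 : Fin 4) ≠ 3 by decide)] <| by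
    have hA := Presented.rel (TetRel.dolanGrady (F := F) (h := 3) (i := 1) (j := 2) (k := 0)
      (by decide) (by decide) (by decide) (by decide) (by decide) (by decide))
    have hB := Presented.rel (TetRel.dolanGrady (F := F) (h := 2) (i := 0) (j := 3) (k := 1)
      (by decide) (by decide) (by decide) (by decide) (by decide) (by decide))
    simp only [map_sub, map_smul, LieHom.map_lie, FreeLieAlgebra.lift_of_apply] at hA hB
    rintro r (_ | _)
    · simp only [map_sub, map_smul, LieHom.map_lie, FreeLieAlgebra.lift_of_apply]
      exact hA
    · simp only [map_sub, map_smul, LieHom.map_lie, FreeLieAlgebra.lift_of_apply]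
      exact hB

@[simp] theorem onsagerToTet_genA :
    onsagerToTet F (genA F) = xGen F (show (1 : Fin 4) ≠ 2 by decide) :=
  Presented.lift_gen _ _ _

@[simp] theorem onsagerToTet_genB :
    onsagerToTet F (genB F) = xGen F (show (0 : Fin 4) ≠ 3 by decide) :=
  Presented.lift_gen _ _ _

/-! ### The three-point `sl₂` loop algebra -/

/-- The Lie algebra `sl₂` of traceless `2 × 2` matrices. -/
def sl2 : Type _ := LieAlgebra.SpecialLinear.sl (Fin 2) F

instance : LieRing (sl2 F) := inferInstanceAs (LieRing (LieAlgebra.SpecialLinear.sl (Fin 2) F))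

instance : LieAlgebra F (sl2 F) :=
  inferInstanceAs (LieAlgebra F (LieAlgebra.SpecialLinear.sl (Fin 2) F))

variable {F} in
/-- The matrix underlying an element of `sl₂`. -/
def sl2.mat (u : sl2 F) : Matrix (Fin 2) (Fin 2) F := Subtype.val u

/-- `e`, the matrix with rows `(0,1)`, `(0,0)`. -/
def e : sl2 F := (LieAlgebra.SpecialLinear.single 0 1 (by decide) (1 : F) : LieAlgebra.SpecialLinear.sl (Fin 2) F)

/-- `f`, the matrix with rows `(0,0)`, `(1,0)`. -/
def f : sl2 F := (LieAlgebra.SpecialLinear.single 1 0 (by decide) (1 : F) : LieAlgebra.SpecialLinear.sl (Fin 2) F)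

/-- `h`, the matrix with rows `(1,0)`, `(0,-1)`. -/
def h : sl2 F := (LieAlgebra.SpecialLinear.singleSubSingle 0 1 (1 : F) : LieAlgebra.SpecialLinear.sl (Fin 2) F)

/-- The equitable basis element `x = 2e - h`. -/
def eqX : sl2 F := (2 : F) • e F - h F

/-- The equitable basis element `y = -2f - h`. -/
def eqY : sl2 F := -((2 : F) • f F) - h F

/-- The equitable basis element `z = h`. -/
def eqZ : sl2 F := h F

theorem sl2.mat_injective : Function.Injective (sl2.mat (F := F)) := Subtype.val_injective

@[simp] theorem sl2.mat_lie (u v : sl2 F) : ⁅u, v⁆.mat = u.mat * v.mat - v.mat * u.mat := rfl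

@[simp] theorem sl2.mat_smul (r : F) (u : sl2 F) : (r • u).mat = r • u.mat := rfl

@[simp] theorem sl2.mat_neg (u : sl2 F) : (-u).mat = -u.mat := rfl

@[simp] theorem mat_e : (e F).mat = !![0, 1; 0, 0] := by
  ext i j; fin_cases i <;> fin_cases j <;> rfl

@[simp] theorem mat_f : (f F).mat = !![0, 0; 1, 0] := by
  ext i j; fin_cases i <;> fin_cases j <;> rfl

@[simp] theorem mat_h : (h F).mat = !![1, 0; 0, -1] := by
  have : (h F).mat = Matrix.single 0 0 1 - Matrix.single 1 1 1 := rfl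
  rw [this]
  ext i j; fin_cases i <;> fin_cases j <;> simp

theorem lie_h_e : ⁅h F, e F⁆ = (2 : F) • e F := by
  apply sl2.mat_injective
  ext i j
  fin_cases i <;> fin_cases j <;> simp
  norm_num

theorem lie_h_f : ⁅h F, f F⁆ = -((2 : F) • f F) := by
  apply sl2.mat_injective
  ext i j
  fin_cases i <;> fin_cases j <;> simp
  norm_num

theorem lie_e_f : ⁅e F, f F⁆ = h F := by
  apply sl2.mat_injective
  ext i j
  fin_cases i <;> fin_cases j <;> simp

theorem lie_eqX_eqY : ⁅eqX F, eqY F⁆ = (2 : F) • eqX F + (2 : F) • eqY F := by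
  have h1 := lie_skew (e F) (h F)
  simp only [eqX, eqY, sub_lie, lie_sub, smul_lie, lie_smul, lie_neg, lie_self, lie_h_f, lie_e_f,
    ← h1, lie_h_e]
  module

theorem lie_eqY_eqZ : ⁅eqY F, eqZ F⁆ = (2 : F) • eqY F + (2 : F) • eqZ F := by
  have h1 := lie_skew (f F) (h F)
  simp only [eqY, eqZ, sub_lie, smul_lie, neg_lie, lie_self, ← h1, lie_h_f]
  module

theorem lie_eqZ_eqX : ⁅eqZ F, eqX F⁆ = (2 : F) • eqZ F + (2 : F) • eqX F := by
  simp only [eqX, eqZ, lie_sub, lie_smul, lie_self, lie_h_e]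
  module

open Polynomial in
/-- The algebra `𝒜 = F[t, t⁻¹, (t-1)⁻¹]`: the polynomial ring with `t(t-1)` inverted. -/
def Laurent : Type _ := Localization.Away ((X * (X - 1) : F[X]))

instance : CommRing (Laurent F) := inferInstanceAs (CommRing (Localization.Away _))

instance : Algebra F (Laurent F) := inferInstanceAs (Algebra F (Localization.Away _))

open Polynomial in
instance : Algebra F[X] (Laurent F) := inferInstanceAs (Algebra F[X] (Localization.Away _))

open Polynomial in
instance : IsScalarTower F F[X] (Laurent F) :=
  inferInstanceAs (IsScalarTower F F[X] (Localization.Away _))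

open Polynomial in
instance : IsLocalization.Away ((X * (X - 1) : F[X])) (Laurent F) :=
  inferInstanceAs (IsLocalization.Away _ (Localization.Away ((X * (X - 1) : F[X]))))

/-- The indeterminate `t`, as a unit of `𝒜`. -/
def tUnit : (Laurent F)ˣ :=
  (isUnit_of_mul_isUnit_left (y := algebraMap (Polynomial F) (Laurent F) (Polynomial.X - 1)) (by
    rw [← map_mul]; exact IsLocalization.Away.algebraMap_isUnit (Polynomial.X * (Polynomial.X - 1) : Polynomial F)) :
    IsUnit (algebraMap (Polynomial F) (Laurent F) Polynomial.X)).unit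

/-- The element `t - 1`, as a unit of `𝒜`. -/
def sUnit : (Laurent F)ˣ :=
  (isUnit_of_mul_isUnit_right (x := algebraMap (Polynomial F) (Laurent F) Polynomial.X) (by
    rw [← map_mul]; exact IsLocalization.Away.algebraMap_isUnit (Polynomial.X * (Polynomial.X - 1) : Polynomial F)) :
    IsUnit (algebraMap (Polynomial F) (Laurent F) (Polynomial.X - 1))).unit

/-- The indeterminate `t` in `𝒜`. -/
def t : Laurent F := algebraMap (Polynomial F) (Laurent F) Polynomial.X

@[simp] theorem coe_tUnit : (tUnit F : Laurent F) = t F := rfl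

@[simp] theorem coe_sUnit : (sUnit F : Laurent F) = t F - 1 := by
  simp [sUnit, t]

/-- `t' = 1 - t⁻¹`. -/
def t' : Laurent F := 1 - ((tUnit F)⁻¹ : (Laurent F)ˣ)

/-- `t'' = (1 - t)⁻¹`. -/
def t'' : Laurent F := ((-(sUnit F))⁻¹ : (Laurent F)ˣ)

/-- The three-point `sl₂` loop algebra `L(sl₂)⁺ = sl₂ ⊗ 𝒜`. Mathlib puts the algebra of scalars
on the left, so `u ⊗ a` is written `a ⊗ₜ u`; the bracket is `[a ⊗ₜ u, b ⊗ₜ v] = (a * b) ⊗ₜ [u, v]`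
and the `𝒜`-module structure is `b • (a ⊗ₜ u) = (b * a) ⊗ₜ u`. -/
abbrev Loop : Type _ := Laurent F ⊗[F] (sl2 F)

variable {F} in
/-- `u ⊗ a`, for `u` in `sl₂` and `a` in `𝒜`. -/
def tens (u : sl2 F) (a : Laurent F) : Loop F := a ⊗ₜ[F] u

/-- The standard generators `x_ij^σ` of the loop algebra (zero, by convention, for `i = j`). -/
def xσ : Fin 4 → Fin 4 → Loop F
  | 1, 2 => tens (eqX F) 1
  | 2, 1 => -tens (eqX F) 1
  | 2, 3 => tens (eqY F) 1
  | 3, 2 => -tens (eqY F) 1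
  | 3, 1 => tens (eqZ F) 1
  | 1, 3 => -tens (eqZ F) 1
  | 0, 3 => tens (eqY F) (t F) + tens (eqZ F) (t F - 1)
  | 3, 0 => -(tens (eqY F) (t F) + tens (eqZ F) (t F - 1))
  | 0, 1 => tens (eqZ F) (t' F) + tens (eqX F) (t' F - 1)
  | 1, 0 => -(tens (eqZ F) (t' F) + tens (eqX F) (t' F - 1))
  | 0, 2 => tens (eqX F) (t'' F) + tens (eqY F) (t'' F - 1)
  | 2, 0 => -(tens (eqX F) (t'' F) + tens (eqY F) (t'' F - 1))
  | _, _ => 0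

variable {F} in
/-- The element `x ⊗ a + y ⊗ b + z ⊗ c`. -/
def vec (a b c : Laurent F) : Loop F := tens (eqX F) a + tens (eqY F) b + tens (eqZ F) c

variable {F} in
theorem lie_vec (a b c a' b' c' : Laurent F) :
    ⁅vec a b c, vec a' b' c'⁆ =
      vec (2 * (a * b' - b * a') + 2 * (c * a' - a * c'))
        (2 * (a * b' - b * a') + 2 * (b * c' - c * b'))
        (2 * (b * c' - c * b') + 2 * (c * a' - a * c')) := by
  have key : ∀ (u : sl2 F) (r : Laurent F), tens u r = r • tens u 1 := by
    intro u r
    rw [tens, tens, TensorProduct.smul_tmul', smul_eq_mul, mul_one]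
  have two : ∀ u : sl2 F, tens ((2 : F) • u) 1 = (2 : Laurent F) • tens u 1 := by
    intro u
    rw [tens, tens, ← TensorProduct.smul_tmul, Algebra.smul_def, map_ofNat,
      TensorProduct.smul_tmul', smul_eq_mul]
  have lie_tens : ∀ u v : sl2 F, ⁅tens u 1, tens v 1⁆ = tens ⁅u, v⁆ 1 := by
    intro u v
    rw [tens, tens, LieAlgebra.ExtendScalars.bracket_tmul, mul_one, tens]
  have tens_add : ∀ u v : sl2 F, tens (u + v) 1 = tens u 1 + tens v 1 :=
    fun u v => TensorProduct.tmul_add _ _ _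
  have e1 : ⁅tens (eqX F) 1, tens (eqY F) 1⁆
      = (2 : Laurent F) • tens (eqX F) 1 + (2 : Laurent F) • tens (eqY F) 1 := by
    rw [lie_tens, lie_eqX_eqY, tens_add, two, two]
  have e2 : ⁅tens (eqY F) 1, tens (eqZ F) 1⁆
      = (2 : Laurent F) • tens (eqY F) 1 + (2 : Laurent F) • tens (eqZ F) 1 := by
    rw [lie_tens, lie_eqY_eqZ, tens_add, two, two]
  have e3 : ⁅tens (eqZ F) 1, tens (eqX F) 1⁆
      = (2 : Laurent F) • tens (eqZ F) 1 + (2 : Laurent F) • tens (eqX F) 1 := by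
    rw [lie_tens, lie_eqZ_eqX, tens_add, two, two]
  have e1' := lie_skew (tens (eqY F) 1) (tens (eqX F) 1)
  have e2' := lie_skew (tens (eqZ F) 1) (tens (eqY F) 1)
  have e3' := lie_skew (tens (eqX F) 1) (tens (eqZ F) 1)
  rw [e1] at e1'
  rw [e2] at e2'
  rw [e3] at e3'
  simp only [vec, key (eqX F) a, key (eqY F) b, key (eqZ F) c, key (eqX F) a', key (eqY F) b',
    key (eqZ F) c', key _ (_ + _)]
  simp only [add_lie, lie_add, smul_lie, lie_smul, lie_self, e1, e2, e3, ← e1', ← e2', ← e3']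
  module

variable {F} in
theorem vec_add (a b c a' b' c' : Laurent F) :
    vec a b c + vec a' b' c' = vec (a + a') (b + b') (c + c') := by
  simp only [vec, tens, TensorProduct.add_tmul]
  abel

variable {F} in
theorem neg_vec (a b c : Laurent F) : -vec a b c = vec (-a) (-b) (-c) := by
  simp only [vec, tens, TensorProduct.neg_tmul]; abel

variable {F} in
theorem smul_vec (r : F) (a b c : Laurent F) :
    r • vec a b c = vec (algebraMap F _ r * a) (algebraMap F _ r * b) (algebraMap F _ r * c) := by
  simp only [vec, tens, smul_add, TensorProduct.smul_tmul', Algebra.smul_def]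

variable {F} in
theorem vec_zero : vec (0 : Laurent F) 0 0 = 0 := by
  simp [vec, tens]

variable {F} in
theorem vec_congr {a b c a' b' c' : Laurent F} (h1 : a = a') (h2 : b = b') (h3 : c = c') :
    vec a b c = vec a' b' c' := by rw [h1, h2, h3]

/-- The coordinates of `x_ij^σ` with respect to `x`, `y`, `z`. -/
theorem xσ_eq_vec :
    xσ F 1 2 = vec 1 0 0 ∧ xσ F 2 1 = vec (-1) 0 0 ∧ xσ F 2 3 = vec 0 1 0 ∧
    xσ F 3 2 = vec 0 (-1) 0 ∧ xσ F 3 1 = vec 0 0 1 ∧ xσ F 1 3 = vec 0 0 (-1) ∧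
    xσ F 0 3 = vec 0 (t F) (t F - 1) ∧ xσ F 3 0 = vec 0 (-t F) (-(t F - 1)) ∧
    xσ F 0 1 = vec (t' F - 1) 0 (t' F) ∧ xσ F 1 0 = vec (-(t' F - 1)) 0 (-t' F) ∧
    xσ F 0 2 = vec (t'' F) (t'' F - 1) 0 ∧ xσ F 2 0 = vec (-t'' F) (-(t'' F - 1)) 0 := by
  refine ⟨?_, ?_, ?_, ?_, ?_, ?_, ?_, ?_, ?_, ?_, ?_, ?_⟩ <;>
    simp only [xσ, vec, tens, TensorProduct.zero_tmul, TensorProduct.neg_tmul] <;> abel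

theorem t_mul_t' : t F * t' F = t F - 1 := by
  have : t F * ((tUnit F)⁻¹ : (Laurent F)ˣ) = 1 := by
    rw [← coe_tUnit]; exact Units.mul_inv _
  rw [t', mul_sub, this, mul_one]

theorem one_sub_t_mul_t'' : (1 - t F) * t'' F = 1 := by
  have : ((-(sUnit F) : (Laurent F)ˣ) : Laurent F) = 1 - t F := by
    rw [Units.val_neg, coe_sUnit]; ring
  rw [t'', ← this]; exact Units.mul_inv _

theorem t'_mul_t'' : t' F * t'' F = t' F - 1 := by
  have r1 := t_mul_t' F
  have r2 := one_sub_t_mul_t'' F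
  have h : t F * (t' F * t'' F) = t F * (t' F - 1) := by
    linear_combination (t'' F - 1) * r1 - r2
  rw [← coe_tUnit] at h
  exact (tUnit F).mul_right_inj.1 h

theorem xσ_skew (i j : Fin 4) : xσ F i j + xσ F j i = 0 := by
  fin_cases i <;> fin_cases j <;> simp [xσ]

theorem xσ_swap (i j : Fin 4) : xσ F j i = -xσ F i j :=
  eq_neg_of_add_eq_zero_left (xσ_skew F j i)

set_option maxHeartbeats 2000000 in
theorem xσ_triangle_aux (i j k : Fin 4) (hij : i ≠ j) (hjk : j ≠ k) (hik : i < k) :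
    ⁅xσ F i j, xσ F j k⁆ = (2 : F) • xσ F i j + (2 : F) • xσ F j k := by
  obtain ⟨h12, h21, h23, h32, h31, h13, h03, h30, h01, h10, h02, h20⟩ := xσ_eq_vec F
  have r1 := t_mul_t' F
  have r2 := one_sub_t_mul_t'' F
  have r3 := t'_mul_t'' F
  fin_cases i <;> fin_cases k <;> (try exact absurd hik (by decide)) <;>
    fin_cases j <;> (try exact absurd rfl hij) <;> (try exact absurd rfl hjk) <;>
    (simp only [Fin.zero_eta, Fin.mk_one, Fin.reduceFinMk, h12, h21, h23, h32, h31, h13, h03,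
      h01, h10, h02, h20, lie_vec, vec_add, smul_vec, map_ofNat]
     apply vec_congr <;> grind)

theorem xσ_triangle (i j k : Fin 4) (hij : i ≠ j) (hjk : j ≠ k) (hik : i ≠ k) :
    ⁅xσ F i j, xσ F j k⁆ = (2 : F) • xσ F i j + (2 : F) • xσ F j k := by
  rcases lt_or_gt_of_ne hik with hlt | hlt
  · exact xσ_triangle_aux F i j k hij hjk hlt
  · have := xσ_triangle_aux F k j i hjk.symm hij.symm hlt
    rw [xσ_swap F j k, xσ_swap F i j, neg_lie, lie_neg, neg_neg, ← lie_skew] at this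
    rw [← neg_inj, this]
    module

set_option maxHeartbeats 2000000 in
theorem xσ_dolanGrady_aux (h i j k : Fin 4) (hhi : h ≠ i) (hhj : h ≠ j) (hij : i < j)
    (hik : i ≠ k) (hjk : j ≠ k) (hkh : k < h) :
    ⁅xσ F i j, ⁅xσ F i j, ⁅xσ F i j, xσ F k h⁆⁆⁆ = (4 : F) • ⁅xσ F i j, xσ F k h⁆ := by
  obtain ⟨h12, h21, h23, h32, h31, h13, h03, h30, h01, h10, h02, h20⟩ := xσ_eq_vec F
  have r1 := t_mul_t' F
  have r2 := one_sub_t_mul_t'' F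
  have r3 := t'_mul_t'' F
  fin_cases i <;> fin_cases j <;> (try exact absurd hij (by decide)) <;>
    fin_cases k <;> (try exact absurd rfl hik) <;> (try exact absurd rfl hjk) <;>
    fin_cases h <;> (try exact absurd rfl hhi) <;> (try exact absurd rfl hhj) <;>
    (try exact absurd hkh (by decide)) <;>
    (simp only [Fin.zero_eta, Fin.mk_one, Fin.reduceFinMk, h12, h23, h13, h03, h01, h02,
      lie_vec, smul_vec, map_ofNat]
     apply vec_congr <;> grind)

theorem xσ_dolanGrady (h i j k : Fin 4) (hhi : h ≠ i) (hhj : h ≠ j) (hij : i ≠ j) (hik : i ≠ k)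
    (hjk : j ≠ k) (hkh : k ≠ h) :
    ⁅xσ F i j, ⁅xσ F i j, ⁅xσ F i j, xσ F k h⁆⁆⁆ = (4 : F) • ⁅xσ F i j, xσ F k h⁆ := by
  rcases lt_or_gt_of_ne hij with h1 | h1 <;> rcases lt_or_gt_of_ne hkh with h2 | h2
  · exact xσ_dolanGrady_aux F h i j k hhi hhj h1 hik hjk h2
  · have := xσ_dolanGrady_aux F k i j h hik.symm hjk.symm h1 hhi.symm hhj.symm h2
    simpa only [xσ_swap F h k, lie_neg, smul_neg, neg_inj] using this
  · have := xσ_dolanGrady_aux F h j i k hhj hhi h1 hjk hik h2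
    simpa only [xσ_swap F j i, lie_neg, neg_lie, smul_neg, neg_neg, neg_inj] using this
  · have := xσ_dolanGrady_aux F k j i h hjk.symm hik.symm h1 hhj.symm hhi.symm h2
    simpa only [xσ_swap F h k, xσ_swap F j i, lie_neg, neg_lie, smul_neg, neg_neg, neg_inj]
      using this

/-- The homomorphism `σ : ⊠ → L(sl₂)⁺` that sends each standard generator `x_ij` to `x_ij^σ`. -/
def sigma : Tet F →ₗ⁅F⁆ Loop F :=
  Presented.lift (fun p => xσ F p.1.1 p.1.2) <| by
    rintro r (hij | ⟨hij, hjk, hik⟩ | ⟨hhi, hhj, hij, hik, hjk, hkh⟩)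
    · simp only [map_add, FreeLieAlgebra.lift_of_apply]
      exact xσ_skew F _ _
    · simp only [map_add, map_sub, map_smul, LieHom.map_lie, FreeLieAlgebra.lift_of_apply]
      exact sub_eq_zero.2 (xσ_triangle F _ _ _ hij hjk hik)
    · simp only [map_sub, map_smul, LieHom.map_lie, FreeLieAlgebra.lift_of_apply]
      exact sub_eq_zero.2 (xσ_dolanGrady F _ _ _ _ hhi hhj hij hik hjk hkh)

@[simp] theorem sigma_xGen {i j : Fin 4} (hij : i ≠ j) : sigma F (xGen F hij) = xσ F i j :=
  Presented.lift_gen _ _ _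

/-- The homomorphism `O → L(sl₂)⁺`, `A ↦ x_12^σ`, `B ↦ x_03^σ`, through which `O` is identified
with a subalgebra of `L(sl₂)⁺`. -/
def onsagerToLoop : Onsager F →ₗ⁅F⁆ Loop F := (sigma F).comp (onsagerToTet F)

/-! ### The elements of the basis -/

/-- `-x ⊗ (t-1)^i`. -/
def basisA (i : ℕ) : Loop F := tens (-eqX F) ((t F - 1) ^ i)

/-- `(-y ⊗ t - z ⊗ (t-1)) (t-1)^i`. -/
def basisB (i : ℕ) : Loop F :=
  ((t F - 1) ^ i) • (-tens (eqY F) (t F) - tens (eqZ F) (t F - 1))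

/-- `(-x ⊗ 1 - y ⊗ t) (t-1)^(i-1)`, with exponent `-1` when `i = 0`. -/
def basisψ (i : ℕ) : Loop F :=
  ((sUnit F ^ ((i : ℤ) - 1) : (Laurent F)ˣ) : Laurent F) •
    (-tens (eqX F) 1 - tens (eqY F) (t F))

end OnsagerTet

end

/-! The Dolan-Grady relations with parameter `c` (`c = 4` for `O`) force the structure of a current
algebra. Put `G 0 = [A 0, B 0]` and define `A n`, `B n` by the recursion that would be
multiplication by `w` in a Lie algebra over `F[w]` of rank three. Induction on the total level shows
that all expected brackets hold (`DolanGradySequence.currentRelations`). Hence `O` is spanned by the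
`A n`, `B n`, `G n`.

Under `ι` the parameter `w` becomes multiplication by `4 - 8t`, which is transcendental over `F`,
and the images of `A 0`, `B 0`, `G 0` are independent over `𝒜`. So the images of the spanning family
are independent, and `ι` is injective. The brackets of the elements in the statement are computed in
the loop algebra; solved for the element of highest index, they put these elements into the image of
`ι`. Independence now comes from the powers of `t - 1`.

The like conditions live in `⊠`. Those for `A i` and `B i` involve only elements of `O`, so they are
checked after `ι`. Those for `ψ (i + 1)` involve `x_02` and `x_31`, which lie outside `O`, and
injectivity of `σ` is not used. Instead, `x_02` serves as `ψ 0` in a recursion inside `⊠`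
(`lie_psi_zero`). For `x_31`, the elements `x_12 + x_31` and `x_03 + x_31` have weights `2` and `-2`
under `ad x_31` and satisfy the Dolan-Grady relations with `c = 0`; the current algebra with `c = 0`
then shows that `ad x_31` has only the eigenvalues `0`, `2`, `-2` on `O + F x_31`
(`lie_cube_of_weights`). -/

noncomputable section

namespace OnsagerTet

/-! ### Consequences of the Dolan-Grady relations -/

section DolanGrady

variable {F : Type*} [Field F] {L : Type*} [LieRing L] [LieAlgebra F L]

/-- The bracket relations of the `F[w]`-Lie algebra with basis `A`, `B`, `G`, where `[A, B] = G`,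
`[G, A] = w A - c B`, `[G, B] = c A - w B`, for the elements `A i = wⁱ A`, `B i = wⁱ B`,
`G i = wⁱ G`. -/
structure CurrentRelations (c : F) (A B G : ℕ → L) : Prop where
  lie_A_A (i j : ℕ) : ⁅A i, A j⁆ = 0
  lie_B_B (i j : ℕ) : ⁅B i, B j⁆ = 0
  lie_G_G (i j : ℕ) : ⁅G i, G j⁆ = 0
  lie_A_B (i j : ℕ) : ⁅A i, B j⁆ = G (i + j)
  lie_A_G (i j : ℕ) : ⁅A i, G j⁆ = c • B (i + j) - A (i + j + 1)
  lie_B_G (i j : ℕ) : ⁅B i, G j⁆ = B (i + j + 1) - c • A (i + j)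

/-- Two sequences `A`, `B` that are generated recursively by the bracket with `G₀ = [A 0, B 0]`,
where `A 0` and `B 0` satisfy the Dolan-Grady relations with parameter `c`. -/
structure DolanGradySequence (c : F) (A B : ℕ → L) (G₀ : L) : Prop where
  A_succ (n : ℕ) : A (n + 1) = ⁅G₀, A n⁆ + c • B n
  B_succ (n : ℕ) : B (n + 1) = c • A n - ⁅G₀, B n⁆
  G_eq : G₀ = ⁅A 0, B 0⁆
  dolanGrady_A : ⁅A 0, ⁅A 0, ⁅A 0, B 0⁆⁆⁆ = c • ⁅A 0, B 0⁆
  dolanGrady_B : ⁅B 0, ⁅B 0, ⁅B 0, A 0⁆⁆⁆ = c • ⁅B 0, A 0⁆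

/-- The brackets of the `A i` and `B j` of total level at most `n` are the expected ones. -/
def RelationsUpTo (A B G : ℕ → L) (n : ℕ) : Prop :=
  ∀ i j, i + j ≤ n → ⁅A i, A j⁆ = 0 ∧ ⁅B i, B j⁆ = 0 ∧ ⁅A i, B j⁆ = G (i + j)

/-- Exchanging `A` with `B` and negating `G` is a symmetry of the whole situation, so statements
about `B` follow from those about `A`. -/
theorem RelationsUpTo.swap {A B G : ℕ → L} {n : ℕ} (H : RelationsUpTo A B G n) :
    RelationsUpTo B A (-G) n := fun i j h =>
  ⟨(H i j h).2.1, (H i j h).1, by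
    rw [← lie_skew, (H j i (by omega)).2.2, add_comm, Pi.neg_apply]⟩

namespace DolanGradySequence

variable {c : F} {A B G : ℕ → L}

theorem swap {G₀ : L} (hs : DolanGradySequence c A B G₀) : DolanGradySequence c B A (-G₀) where
  A_succ n := by rw [hs.B_succ, neg_lie]; abel
  B_succ n := by rw [hs.A_succ, neg_lie]; abel
  G_eq := by rw [hs.G_eq, lie_skew]
  dolanGrady_A := hs.dolanGrady_B
  dolanGrady_B := hs.dolanGrady_A

/-- The Leibniz rule for `ad (A 0)` on `G (i + j) = [A i, B j]` gives `[A 0, G (i + j)] = [A i, G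
j]`, so only the total level matters. One choice of indices puts `G 0` in the bracket, where the
recursion gives the value. -/
theorem lie_A_G_of (hs : DolanGradySequence c A B (G 0)) {n : ℕ} (H : RelationsUpTo A B G n)
    {i j : ℕ} (hij : i + j ≤ n) : ⁅A i, G j⁆ = c • B (i + j) - A (i + j + 1) := by
  have key : ∀ i j, i + j ≤ n → ⁅A 0, G (i + j)⁆ = ⁅A i, G j⁆ := by
    intro i j h
    rw [← (H i j h).2.2, leibniz_lie, (H 0 i (by omega)).1, zero_lie, zero_add,
      (H 0 j (by omega)).2.2, zero_add]
  have h0 := key (i + j) 0 (by omega)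
  rw [add_zero] at h0
  rw [← key i j hij, h0, hs.A_succ, ← lie_skew]
  abel

theorem lie_B_G_of (hs : DolanGradySequence c A B (G 0)) {n : ℕ} (H : RelationsUpTo A B G n)
    {i j : ℕ} (hij : i + j ≤ n) : ⁅B i, G j⁆ = B (i + j + 1) - c • A (i + j) := by
  have h := lie_A_G_of (G := -G) hs.swap H.swap hij
  rw [Pi.neg_apply, lie_neg] at h
  rw [← neg_inj, h]
  abel

variable [CharZero F]

theorem lie_A_A_of (hs : DolanGradySequence c A B (G 0)) {n : ℕ} (H : RelationsUpTo A B G n)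
    {i j : ℕ} (hij : i + j = n + 1) : ⁅A i, A j⁆ = 0 := by
  -- The Leibniz rule for `ad (A 0)` on `[A i, G j]` makes all these brackets equal.
  have h0 : ∀ i j, i + j = n → ⁅A i, A (j + 1)⁆ = ⁅A 0, A (n + 1)⁆ := by
    intro i j h
    have e1 := leibniz_lie (A 0) (A i) (G j)
    rw [hs.lie_A_G_of H h.le, hs.lie_A_G_of H (i := 0) (by omega), (H 0 i (by omega)).1, zero_lie,
      zero_add, lie_sub, lie_sub, lie_smul, lie_smul, zero_add, (H i j h.le).2.2,
      (H 0 (i + j) (by omega)).2.2, zero_add, h] at e1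
    simpa using e1.symm
  have h1 : ⁅A 0, A (n + 1)⁆ = 0 := by
    rcases n with _ | n
    · have e := hs.dolanGrady_A
      rw [← hs.G_eq] at e
      rw [hs.A_succ, lie_add, lie_smul, ← hs.G_eq, ← lie_skew (G 0), lie_neg, e]
      simp
    -- `ad (G 0)` applied to `[A 0, A (n + 1)] = 0` gives `[A 1, A (n + 1)] + [A 0, A (n + 2)]`,
    -- because the terms with `c` cancel. By `h0` the two summands agree. Level one, above, is the
    -- Dolan-Grady relation itself.
    · have e1 := congrArg (fun z => ⁅G 0, z⁆) (H 0 (n + 1) (by omega)).1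
      have hD : ∀ k, ⁅G 0, A k⁆ = A (k + 1) - c • B k := fun k => by rw [hs.A_succ]; abel
      have e2 := (H (n + 1) 0 (by omega)).2.2
      have e3 := (H 0 (n + 1) (by omega)).2.2
      have e4 := h0 1 n (by omega)
      simp only [leibniz_lie (G 0), lie_zero, hD, sub_lie, lie_sub, smul_lie, lie_smul, e3, e4,
        ← lie_skew (B 0), e2, zero_add, add_zero] at e1
      have : (2 : F) • ⁅A 0, A (n + 1 + 1)⁆ = 0 := by
        rw [← e1]; module
      exact (smul_eq_zero_iff_right two_ne_zero).1 this
  rcases j with _ | j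
  · rw [← lie_skew, show i = n + 1 by omega, h1, neg_zero]
  · rw [h0 i j (by omega), h1]

theorem lie_B_B_of (hs : DolanGradySequence c A B (G 0)) {n : ℕ} (H : RelationsUpTo A B G n)
    {i j : ℕ} (hij : i + j = n + 1) : ⁅B i, B j⁆ = 0 :=
  lie_A_A_of (G := -G) hs.swap H.swap hij

/-- Applying `ad (G 0)` to `[A i, B j] = G n` shows that on level `n + 1` the bracket `[A i, B j]`
is affine in `i` with slope `[G 0, G n]`. Applying `ad (B 0)` to `[A i, G j]` gives a second
expression for the end value `[A (n + 1), B 0]`, and the comparison kills the slope. -/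
theorem lie_A_B_and_lie_G_G_of (hs : DolanGradySequence c A B (G 0)) {n : ℕ}
    (H : RelationsUpTo A B G n) (hG : G (n + 1) = ⁅A 0, B (n + 1)⁆) :
    (∀ i j, i + j = n + 1 → ⁅A i, B j⁆ = G (n + 1)) ∧ ∀ i j, i + j = n → ⁅G i, G j⁆ = 0 := by
  have hDA : ∀ k, ⁅G 0, A k⁆ = A (k + 1) - c • B k := fun k => by rw [hs.A_succ]; abel
  have hDB : ∀ k, ⁅G 0, B k⁆ = c • A k - B (k + 1) := fun k => by rw [hs.B_succ]; abel
  have step : ∀ i j, i + j = n → ⁅A (i + 1), B j⁆ = ⁅A i, B (j + 1)⁆ + ⁅G 0, G n⁆ := by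
    intro i j h
    have e := leibniz_lie (G 0) (A i) (B j)
    rw [(H i j h.le).2.2, hDA, hDB, sub_lie, lie_sub, smul_lie, lie_smul, (H i j h.le).1,
      (H i j h.le).2.1, h] at e
    rw [e, smul_zero]
    abel
  have lin : ∀ i j, i + j = n + 1 → ⁅A i, B j⁆ = G (n + 1) + (i : F) • ⁅G 0, G n⁆ := by
    intro i
    induction i with
    | zero => intro j h; rw [show j = n + 1 by omega, hG]; simp
    | succ i ih =>
      intro j h
      rw [step i j (by omega), ih (j + 1) (by omega)]
      push_cast
      module
  have top : ∀ i j, i + j = n → ⁅A (n + 1), B 0⁆ = ⁅A i, B (j + 1)⁆ - ⁅G i, G j⁆ := by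
    intro i j h
    have e := leibniz_lie (B 0) (A i) (G j)
    have hi := (H i 0 (by omega)).2.2
    have hn := (H n 0 (by omega)).2.2
    rw [hs.lie_A_G_of H h.le, hs.lie_B_G_of H (i := 0) (by omega), ← lie_skew (B 0) (A i), hi,
      lie_sub, lie_sub, lie_smul, lie_smul, zero_add, (H i j h.le).1, neg_lie, h,
      (H 0 n (by omega)).2.1, ← lie_skew (B 0), add_zero] at e
    rw [sub_eq_neg_add, ← sub_zero ⁅A i, B (j + 1)⁆]
    simpa using e
  have h0 : ⁅G 0, G n⁆ = 0 := by
    have e1 := top 0 n (by omega)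
    rw [lin (n + 1) 0 (by omega), lin 0 (n + 1) (by omega)] at e1
    -- The affine formula gives `[A (n + 1), B 0] = G (n + 1) + (n + 1) [G 0, G n]`, while `top`
    -- gives `G (n + 1) - [G 0, G n]`. As `n` is arbitrary, the division uses characteristic zero.
    have : ((n + 2 : ℕ) : F) • ⁅G 0, G n⁆ = 0 := by
      have e2 := sub_eq_zero.2 e1
      rw [← e2]
      push_cast
      module
    exact (smul_eq_zero_iff_right (by exact_mod_cast (by omega : n + 2 ≠ 0))).1 this
  have hq : ∀ i j, i + j = n + 1 → ⁅A i, B j⁆ = G (n + 1) := by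
    intro i j h
    rw [lin i j h, h0, smul_zero, add_zero]
  refine ⟨hq, fun i j h => ?_⟩
  have e := top i j h
  rw [hq _ _ (by omega), hq _ _ (by omega)] at e
  exact sub_eq_self.1 e.symm

theorem currentRelations (hs : DolanGradySequence c A B (G 0)) (hG : ∀ n, G n = ⁅A 0, B n⁆) :
    CurrentRelations c A B G := by
  have H : ∀ n, RelationsUpTo A B G n := by
    intro n
    induction n with
    | zero =>
      intro i j h
      obtain ⟨rfl, rfl⟩ : i = 0 ∧ j = 0 := by omega
      exact ⟨lie_self _, lie_self _, (hG 0).symm⟩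
    | succ n ih =>
      intro i j h
      rcases Nat.le_or_eq_of_le_succ h with h | h
      · exact ih i j h
      · exact ⟨hs.lie_A_A_of ih h, hs.lie_B_B_of ih h, by
          rw [h]; exact (hs.lie_A_B_and_lie_G_G_of ih (hG _)).1 i j h⟩
  exact
    { lie_A_A := fun i j => (H _ i j le_rfl).1
      lie_B_B := fun i j => (H _ i j le_rfl).2.1
      lie_G_G := fun i j => (hs.lie_A_B_and_lie_G_G_of (H (i + j)) (hG _)).2 i j rfl
      lie_A_B := fun i j => (H _ i j le_rfl).2.2
      lie_A_G := fun i j => hs.lie_A_G_of (H _) le_rfl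
      lie_B_G := fun i j => hs.lie_B_G_of (H _) le_rfl }

end DolanGradySequence

/-- The pairs `(A n, B n)` of the Dolan-Grady sequences that start at `a` and `b`. -/
def dolanGradyPair (c : F) (a b : L) : ℕ → L × L
  | 0 => (a, b)
  | n + 1 => (⁅⁅a, b⁆, (dolanGradyPair c a b n).1⁆ + c • (dolanGradyPair c a b n).2,
      c • (dolanGradyPair c a b n).1 - ⁅⁅a, b⁆, (dolanGradyPair c a b n).2⁆)

/-- Used with `c = 4` in `O` and with `c = 0` in the proof that `ad x_31` has eigenvalues `0`, `2`,
`-2`. -/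
theorem exists_currentRelations [CharZero F] {c : F} {a b : L}
    (ha : ⁅a, ⁅a, ⁅a, b⁆⁆⁆ = c • ⁅a, b⁆) (hb : ⁅b, ⁅b, ⁅b, a⁆⁆⁆ = c • ⁅b, a⁆) :
    ∃ A B G : ℕ → L, A 0 = a ∧ B 0 = b ∧ CurrentRelations c A B G := by
  refine ⟨fun n => (dolanGradyPair c a b n).1, fun n => (dolanGradyPair c a b n).2,
    fun n => ⁅a, (dolanGradyPair c a b n).2⁆, rfl, rfl, ?_⟩
  apply DolanGradySequence.currentRelations
  · exact ⟨fun n => rfl, fun n => rfl, rfl, ha, hb⟩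
  · exact fun n => rfl

end DolanGrady

/-! ### Spanning sets closed under the bracket -/

section Generation

variable {F : Type*} [Field F] {L : Type*} [LieRing L] [LieAlgebra F L]

/-- A homomorphism from a presented Lie algebra takes its values in every Lie subalgebra that
contains the images of the generators. -/
theorem Presented.map_mem {X : Type*} {rels : Set (FreeLieAlgebra F X)}
    (φ : Presented F X rels →ₗ⁅F⁆ L) (K : LieSubalgebra F L)
    (hK : ∀ a, φ (Presented.gen rels a) ∈ K) (ξ : Presented F X rels) : φ ξ ∈ K := by
  obtain ⟨u, rfl⟩ := LieSubmodule.Quotient.surjective_mk' _ ξ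
  have h : φ.comp (FreeLieAlgebra.lift F (Presented.gen rels)) =
      K.incl.comp (FreeLieAlgebra.lift F fun a => (⟨φ (Presented.gen rels a), hK a⟩ : K)) := by
    apply FreeLieAlgebra.hom_ext
    intro a
    simp
  have hu := LieHom.congr_fun h u
  rw [LieSubmodule.Quotient.mk'_apply, Presented.mk_eq_lift_gen]
  rw [LieHom.comp_apply, LieHom.comp_apply] at hu
  rw [hu]
  exact Subtype.property _

/-- A span that contains the brackets of its generators is a Lie subalgebra. -/
def spanLieSubalgebra (s : Set L) (hs : ∀ u ∈ s, ∀ v ∈ s, ⁅u, v⁆ ∈ Submodule.span F s) :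
    LieSubalgebra F L :=
  { Submodule.span F s with
    lie_mem' := by
      intro u v hu hv
      exact Submodule.span_induction₂ (p := fun u v _ _ => ⁅u, v⁆ ∈ Submodule.span F s)
        (fun u v hu hv => hs u hu v hv) (fun v _ => by simp) (fun u _ => by simp)
        (fun u v w _ _ _ h1 h2 => by rw [add_lie]; exact add_mem h1 h2)
        (fun u v w _ _ _ h1 h2 => by rw [lie_add]; exact add_mem h1 h2)
        (fun r u v _ _ h => by rw [smul_lie]; exact Submodule.smul_mem _ _ h)
        (fun r u v _ _ h => by rw [lie_smul]; exact Submodule.smul_mem _ _ h) hu hv }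

/-- Three sequences as one family. -/
def family {V : Type*} (A B G : ℕ → V) : ℕ ⊕ ℕ ⊕ ℕ → V := Sum.elim A (Sum.elim B G)

theorem lie_mem_span_family {A B G : ℕ → L} (S : Submodule F L)
    (hAA : ∀ i j, ⁅A i, A j⁆ ∈ S) (hBB : ∀ i j, ⁅B i, B j⁆ ∈ S) (hGG : ∀ i j, ⁅G i, G j⁆ ∈ S)
    (hAB : ∀ i j, ⁅A i, B j⁆ ∈ S) (hAG : ∀ i j, ⁅A i, G j⁆ ∈ S) (hBG : ∀ i j, ⁅B i, G j⁆ ∈ S) :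
    ∀ u ∈ Set.range (family A B G), ∀ v ∈ Set.range (family A B G), ⁅u, v⁆ ∈ S := by
  have swap : ∀ {u v : L}, ⁅u, v⁆ ∈ S → ⁅v, u⁆ ∈ S := by
    intro u v h
    rw [← lie_skew]
    exact neg_mem h
  rintro _ ⟨i | i | i, rfl⟩ _ ⟨j | j | j, rfl⟩ <;> simp only [family, Sum.elim_inl, Sum.elim_inr]
  exacts [hAA i j, hAB i j, hAG i j, swap (hAB j i), hBB i j, hBG i j, swap (hAG j i),
    swap (hBG j i), hGG i j]

section Mem

variable {V : Type*} [AddCommGroup V] [Module F V] (A B G : ℕ → V) (i : ℕ)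

theorem mem_span_family_A : A i ∈ Submodule.span F (Set.range (family A B G)) :=
  Submodule.subset_span ⟨.inl i, rfl⟩

theorem mem_span_family_B : B i ∈ Submodule.span F (Set.range (family A B G)) :=
  Submodule.subset_span ⟨.inr (.inl i), rfl⟩

theorem mem_span_family_G : G i ∈ Submodule.span F (Set.range (family A B G)) :=
  Submodule.subset_span ⟨.inr (.inr i), rfl⟩

end Mem

theorem CurrentRelations.lie_mem {c : F} {A B G : ℕ → L} (hr : CurrentRelations c A B G) :
    ∀ u ∈ Set.range (family A B G), ∀ v ∈ Set.range (family A B G),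
      ⁅u, v⁆ ∈ Submodule.span F (Set.range (family A B G)) := by
  have hA := mem_span_family_A (F := F) A B G
  have hB := mem_span_family_B (F := F) A B G
  have hG := mem_span_family_G (F := F) A B G
  apply lie_mem_span_family
  · intro i j; rw [hr.lie_A_A]; exact zero_mem _
  · intro i j; rw [hr.lie_B_B]; exact zero_mem _
  · intro i j; rw [hr.lie_G_G]; exact zero_mem _
  · intro i j; rw [hr.lie_A_B]; exact hG _
  · intro i j; rw [hr.lie_A_G]; exact sub_mem (Submodule.smul_mem _ _ (hB _)) (hA _)
  · intro i j; rw [hr.lie_B_G]; exact sub_mem (hB _) (Submodule.smul_mem _ _ (hA _))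

end Generation

variable (F : Type*) [Field F]

theorem genA_dolanGrady :
    ⁅genA F, ⁅genA F, ⁅genA F, genB F⁆⁆⁆ = (4 : F) • ⁅genA F, genB F⁆ := by
  have h := Presented.rel (OnsagerRel.dg1 (F := F))
  simp only [map_sub, map_smul, LieHom.map_lie, FreeLieAlgebra.lift_of_apply] at h
  exact sub_eq_zero.1 h

theorem genB_dolanGrady :
    ⁅genB F, ⁅genB F, ⁅genB F, genA F⁆⁆⁆ = (4 : F) • ⁅genB F, genA F⁆ := by
  have h := Presented.rel (OnsagerRel.dg2 (F := F))
  simp only [map_sub, map_smul, LieHom.map_lie, FreeLieAlgebra.lift_of_apply] at h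
  exact sub_eq_zero.1 h

variable {F}

theorem Onsager.map_mem {L : Type*} [LieRing L] [LieAlgebra F L] (φ : Onsager F →ₗ⁅F⁆ L)
    (K : LieSubalgebra F L) (hA : φ (genA F) ∈ K) (hB : φ (genB F) ∈ K) (ξ : Onsager F) :
    φ ξ ∈ K := by
  refine Presented.map_mem φ K (fun a => ?_) ξ
  fin_cases a
  exacts [hA, hB]

theorem onsagerToLoop_genA : onsagerToLoop F (genA F) = vec 1 0 0 := by
  rw [onsagerToLoop, LieHom.comp_apply, onsagerToTet_genA, sigma_xGen, (xσ_eq_vec F).1]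

theorem onsagerToLoop_genB : onsagerToLoop F (genB F) = vec 0 (t F) (t F - 1) := by
  rw [onsagerToLoop, LieHom.comp_apply, onsagerToTet_genB, sigma_xGen]
  exact (xσ_eq_vec F).2.2.2.2.2.2.1

/-! ### Linear independence in the loop algebra -/

theorem smul_vec' (r a b c : Laurent F) : r • vec a b c = vec (r * a) (r * b) (r * c) := by
  simp only [vec, tens, smul_add, TensorProduct.smul_tmul', smul_eq_mul]

theorem sub_vec (a b c a' b' c' : Laurent F) :
    vec a b c - vec a' b' c' = vec (a - a') (b - b') (c - c') := by
  rw [sub_eq_add_neg, neg_vec, vec_add]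
  simp only [sub_eq_add_neg]

/-- The `(i, j)` entry of an element of the loop algebra. -/
def loopEntry (i j : Fin 2) : Loop F →ₗ[F] Laurent F :=
  (TensorProduct.rid F (Laurent F)).toLinearMap ∘ₗ
    LinearMap.lTensor (Laurent F)
      ({ toFun := fun u => u.mat i j, map_add' := fun _ _ => rfl, map_smul' := fun _ _ => rfl } :
        sl2 F →ₗ[F] F)

theorem loopEntry_tens (i j : Fin 2) (u : sl2 F) (a : Laurent F) :
    loopEntry i j (tens u a) = u.mat i j • a := by
  rw [loopEntry, tens, LinearMap.comp_apply, LinearMap.lTensor_tmul, LinearEquiv.coe_coe,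
    TensorProduct.rid_tmul]
  rfl

/-- The matrix entries at `(0,1)`, `(1,0)` and `(0,0)` are `2a`, `-2b` and `-a - b + c`. -/
theorem vec_eq_zero [CharZero F] {a b c : Laurent F} (h : vec a b c = 0) :
    a = 0 ∧ b = 0 ∧ c = 0 := by
  have sub : ∀ u v : sl2 F, (u - v).mat = u.mat - v.mat := fun _ _ => rfl
  have h01 := congrArg (loopEntry 0 1) h
  have h10 := congrArg (loopEntry 1 0) h
  have h00 := congrArg (loopEntry 0 0) h
  simp only [vec, map_add, loopEntry_tens, eqX, eqY, eqZ, sub, sl2.mat_neg, sl2.mat_smul, mat_e,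
    mat_f, mat_h, map_zero] at h01 h10 h00
  simp at h01 h10 h00
  obtain rfl := h01
  obtain rfl := h10
  simpa using h00

theorem algebraMap_laurent_injective :
    Function.Injective (algebraMap (Polynomial F) (Laurent F)) :=
  IsLocalization.injective (M := Submonoid.powers (Polynomial.X * (Polynomial.X - 1))) _
    (powers_le_nonZeroDivisors_of_noZeroDivisors
      (mul_ne_zero Polynomial.X_ne_zero (Polynomial.X_sub_C_ne_zero 1)))

theorem transcendental_algebraMap_laurent {p : Polynomial F} (hp : p.natDegree ≠ 0) :
    Transcendental F (algebraMap (Polynomial F) (Laurent F) p) :=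
  (transcendental_algebraMap_iff algebraMap_laurent_injective).2
    (Polynomial.transcendental p hp (by
      apply mem_nonZeroDivisors_of_ne_zero
      rw [Polynomial.leadingCoeff_ne_zero]
      rintro rfl
      simp at hp))

/-- The elements `wⁱ mₖ` are linearly independent over `F` if the `mₖ` are linearly independent
over `𝒜` and `w` is transcendental. -/
theorem linearIndependent_family {w : Laurent F} (hw : Transcendental F w) {m₁ m₂ m₃ : Loop F}
    (hm : LinearIndependent (Laurent F) ![m₁, m₂, m₃]) :
    LinearIndependent F
      (family (fun i => w ^ i • m₁) (fun i => w ^ i • m₂) (fun i => w ^ i • m₃)) := by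
  have hpow : LinearIndependent F fun i : ℕ => w ^ i := by
    have h := (Polynomial.basisMonomials F).linearIndependent.map'
      (Polynomial.aeval w).toLinearMap
      (LinearMap.ker_eq_bot.2 (transcendental_iff_injective.1 hw))
    have e : (fun i : ℕ => w ^ i) =
        (Polynomial.aeval w).toLinearMap ∘ (Polynomial.basisMonomials F) := by
      ext i
      simp [Polynomial.aeval_monomial]
    rw [e]
    exact h
  have h := (linearIndependent_smul hpow hm).comp
    (Sum.elim (fun i => (i, 0)) (Sum.elim (fun i => (i, 1)) fun i => (i, 2)) :
      ℕ ⊕ ℕ ⊕ ℕ → ℕ × Fin 3) (by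
      rintro (i | i | i) (j | j | j) h <;> simp_all)
  convert h using 1
  ext (i | i | i) <;> rfl

theorem linearIndependent_triple {m₁ m₂ m₃ : Loop F}
    (h : ∀ a b c : Laurent F, a • m₁ + b • m₂ + c • m₃ = 0 → a = 0 ∧ b = 0 ∧ c = 0) :
    LinearIndependent (Laurent F) ![m₁, m₂, m₃] := by
  rw [Fintype.linearIndependent_iff]
  intro g hg i
  rw [Fin.sum_univ_three] at hg
  obtain ⟨h0, h1, h2⟩ := h _ _ _ hg
  fin_cases i
  exacts [h0, h1, h2]

/-! ### Injectivity of the map from the Onsager algebra to the loop algebra -/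

/-- The factor `4 - 8t` is the value of `w`, read off from `w A = [G, A] + 4 B` in the loop algebra.
-/
theorem image_currentRelations {A B G : ℕ → Onsager F} (hA0 : A 0 = genA F) (hB0 : B 0 = genB F)
    (hr : CurrentRelations (4 : F) A B G) (n : ℕ) :
    onsagerToLoop F (A n) = (4 - 8 * t F) ^ n • vec 1 0 0 ∧
    onsagerToLoop F (B n) = (4 - 8 * t F) ^ n • vec 0 (t F) (t F - 1) ∧
    onsagerToLoop F (G n) = (4 - 8 * t F) ^ n • vec 2 (2 * t F) (2 - 2 * t F) := by
  have hG : ∀ n, G n = ⁅A 0, B n⁆ := fun n => by rw [hr.lie_A_B, zero_add]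
  have hA : ∀ n, A (n + 1) = (4 : F) • B n - ⁅A n, G 0⁆ := fun n => by rw [hr.lie_A_G]; simp
  have hB : ∀ n, B (n + 1) = ⁅B n, G 0⁆ + (4 : F) • A n := fun n => by rw [hr.lie_B_G]; simp
  have hι0 : onsagerToLoop F (G 0) = vec 2 (2 * t F) (2 - 2 * t F) := by
    rw [hG, LieHom.map_lie, hA0, hB0, onsagerToLoop_genA, onsagerToLoop_genB, lie_vec]
    apply vec_congr <;> ring
  have hAB : ∀ n, onsagerToLoop F (A n) = (4 - 8 * t F) ^ n • vec 1 0 0 ∧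
      onsagerToLoop F (B n) = (4 - 8 * t F) ^ n • vec 0 (t F) (t F - 1) := by
    intro n
    induction n with
    | zero => rw [hA0, hB0, onsagerToLoop_genA, onsagerToLoop_genB]; simp
    | succ n ih =>
      rw [hA, hB, map_sub, map_add, map_smul, map_smul, LieHom.map_lie, LieHom.map_lie, ih.1, ih.2,
        hι0]
      simp only [smul_vec', smul_vec, lie_vec, sub_vec, vec_add, map_ofNat]
      constructor <;> apply vec_congr <;> ring
  refine ⟨(hAB n).1, (hAB n).2, ?_⟩
  rw [hG, LieHom.map_lie, hA0, onsagerToLoop_genA, (hAB n).2]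
  simp only [smul_vec', lie_vec]
  apply vec_congr <;> ring

theorem isUnit_t : IsUnit (t F) := ⟨tUnit F, coe_tUnit F⟩

theorem isUnit_t_sub_one : IsUnit (t F - 1) := ⟨sUnit F, coe_sUnit F⟩

theorem linearIndependent_generators [CharZero F] : LinearIndependent (Laurent F)
    ![vec 1 0 0, vec 0 (t F) (t F - 1), vec 2 (2 * t F) (2 - 2 * t F)] := by
  apply linearIndependent_triple
  intro a b c h
  simp only [smul_vec', vec_add] at h
  obtain ⟨h1, h2, h3⟩ := vec_eq_zero h
  have h2' : t F * (b + 2 * c) = 0 := by linear_combination h2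
  have h3' : (t F - 1) * (b - 2 * c) = 0 := by linear_combination h3
  rw [isUnit_t.mul_right_eq_zero] at h2'
  rw [isUnit_t_sub_one.mul_right_eq_zero] at h3'
  have h4 : (4 : F) • c = 0 := by
    rw [Algebra.smul_def, map_ofNat]
    linear_combination h2' - h3'
  have hc : c = 0 := (smul_eq_zero_iff_right (by norm_num : (4 : F) ≠ 0)).1 h4
  subst hc
  simp_all

theorem transcendental_four_sub [CharZero F] : Transcendental F (4 - 8 * t F) := by
  have h : (4 - 8 * t F : Laurent F) = algebraMap (Polynomial F) (Laurent F)
      (Polynomial.C (-8) * Polynomial.X + Polynomial.C 4) := by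
    rw [map_add, map_mul, ← t, ← Polynomial.algebraMap_eq, ← IsScalarTower.algebraMap_apply,
      ← IsScalarTower.algebraMap_apply, map_neg, map_ofNat, map_ofNat]
    ring
  rw [h]
  apply transcendental_algebraMap_laurent
  rw [Polynomial.natDegree_linear (by norm_num)]
  exact one_ne_zero

theorem transcendental_t_sub_one : Transcendental F (t F - 1) := by
  have h : (t F - 1 : Laurent F) = algebraMap (Polynomial F) (Laurent F)
      (Polynomial.X - Polynomial.C 1) := by
    rw [map_sub, ← t, map_one, map_one]
  rw [h]
  apply transcendental_algebraMap_laurent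
  rw [Polynomial.natDegree_X_sub_C]
  exact one_ne_zero

/-- The family spans `O`, but its independence is not known beforehand. It is the independence of
the image that makes the span, which is all of `O`, meet the kernel trivially. -/
theorem onsagerToLoop_injective [CharZero F] : Function.Injective (onsagerToLoop F) := by
  obtain ⟨A, B, G, hA0, hB0, hr⟩ := exists_currentRelations (genA_dolanGrady F) (genB_dolanGrady F)
  have hspan : Submodule.span F (Set.range (family A B G)) = ⊤ := by
    rw [eq_top_iff]
    intro ξ _
    refine Onsager.map_mem (LieHom.id : Onsager F →ₗ⁅F⁆ Onsager F)
      (spanLieSubalgebra _ hr.lie_mem) ?_ ?_ ξ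
    · exact hA0 ▸ mem_span_family_A A B G 0
    · exact hB0 ▸ mem_span_family_B A B G 0
  have hli : LinearIndependent F ((onsagerToLoop F : Onsager F →ₗ[F] Loop F) ∘ family A B G) := by
    have h := linearIndependent_family (transcendental_four_sub (F := F))
      linearIndependent_generators
    have e : (onsagerToLoop F : Onsager F →ₗ[F] Loop F) ∘ family A B G = family
        (fun i => (4 - 8 * t F) ^ i • vec 1 0 0)
        (fun i => (4 - 8 * t F) ^ i • vec 0 (t F) (t F - 1))
        (fun i => (4 - 8 * t F) ^ i • vec 2 (2 * t F) (2 - 2 * t F)) := by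
      ext1 (i | i | i)
      exacts [(image_currentRelations hA0 hB0 hr i).1, (image_currentRelations hA0 hB0 hr i).2.1,
        (image_currentRelations hA0 hB0 hr i).2.2]
    rw [e]
    exact h
  have hk := Submodule.range_ker_disjoint hli
  rw [hspan, top_disjoint] at hk
  exact LinearMap.ker_eq_bot.1 hk

/-! ### The brackets of the basis elements -/

theorem basisA_eq_vec (i : ℕ) : basisA F i = vec (-(t F - 1) ^ i) 0 0 := by
  simp [basisA, vec, tens, TensorProduct.neg_tmul, TensorProduct.tmul_neg]

theorem basisB_eq_smul (i : ℕ) :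
    basisB F i = (t F - 1) ^ i • vec 0 (-t F) (-(t F - 1)) := by
  rw [basisB]
  congr 1
  simp only [vec, tens, TensorProduct.neg_tmul, TensorProduct.zero_tmul]
  abel

theorem basisψ_eq_smul (i : ℕ) :
    basisψ F i = ((sUnit F ^ ((i : ℤ) - 1) : (Laurent F)ˣ) : Laurent F) • vec (-1) (-t F) 0 := by
  rw [basisψ]
  congr 1
  simp only [vec, tens, TensorProduct.neg_tmul, TensorProduct.zero_tmul]
  abel

theorem basisψ_succ (i : ℕ) : basisψ F (i + 1) = (t F - 1) ^ i • vec (-1) (-t F) 0 := by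
  rw [basisψ_eq_smul]
  congr 1
  simp

theorem basis_brackets (i j : ℕ) :
    ⁅basisA F i, basisA F j⁆ = 0 ∧
    ⁅basisB F i, basisB F j⁆ = 0 ∧
    ⁅basisψ F i, basisψ F j⁆ = 0 ∧
    ⁅basisψ F i, basisA F j⁆ = (2 : F) • basisψ F (i + j) + (2 : F) • basisA F (i + j) ∧
    ⁅basisB F i, basisψ F j⁆ = (2 : F) • basisB F (i + j) + (2 : F) • basisψ F (i + j) ∧
    ⁅basisA F i, basisB F j⁆
      = (2 : F) • basisA F (i + j) + (2 : F) • basisB F (i + j)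
        - (4 : F) • basisψ F (i + j + 1) := by
  -- `p k` is `(t - 1)^(k - 1)`, with a true inverse at `k = 0`. Multiplication by a power of `t -
  -- 1` shifts the index (`h1`), and a single factor turns `p k` into an ordinary power (`h2`).
  set p : ℕ → Laurent F := fun k => ((sUnit F ^ ((k : ℤ) - 1) : (Laurent F)ˣ) : Laurent F) with hp
  have h1 : ∀ k l, p k * (t F - 1) ^ l = p (k + l) := by
    intro k l
    rw [hp, ← coe_sUnit, ← Units.val_pow_eq_pow_val, ← Units.val_mul, ← zpow_natCast, ← zpow_add]
    congr 2
    push_cast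
    ring
  have h2 : ∀ k, p k * (t F - 1) = (t F - 1) ^ k := by
    intro k
    have h := h1 k 1
    rw [pow_one] at h
    rw [h, hp]
    simp
  have hψ : ∀ k, basisψ F k = vec (-p k) (-(p k * t F)) 0 := by
    intro k
    rw [basisψ_eq_smul, smul_vec']
    apply vec_congr <;> simp [hp]
  simp only [basisA_eq_vec, basisB_eq_smul, basisψ_succ, smul_vec', hψ, lie_vec, smul_vec, vec_add,
    sub_vec, map_ofNat, ← vec_zero (F := F)]
  have h3 := h1 i j
  have h4 := h1 j i
  have h5 := h2 (i + j)
  rw [add_comm j i] at h4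
  refine ⟨?_, ?_, ?_, ?_, ?_, ?_⟩ <;> apply vec_congr
  · ring
  · ring
  · ring
  · ring
  · ring
  · ring
  · ring
  · ring
  · ring
  · linear_combination (-2 * t F) * h3 - 2 * h5
  · linear_combination (-2 * t F) * h3
  · ring
  · linear_combination -2 * h4
  · linear_combination (-2 * t F ^ 2) * h4 - 2 * t F * h5
  · linear_combination (-2 * (t F - 1) ^ 2) * h4 - 2 * (t F - 1) * h5
  · ring
  · ring
  · ring

/-! ### The basis of the Onsager algebra -/

theorem basisA_zero : basisA F 0 = onsagerToLoop F (-genA F) := by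
  rw [map_neg, onsagerToLoop_genA, basisA_eq_vec, neg_vec]
  apply vec_congr <;> simp

theorem basisB_zero : basisB F 0 = onsagerToLoop F (-genB F) := by
  rw [map_neg, onsagerToLoop_genB, basisB_eq_smul, pow_zero, one_smul, neg_vec, neg_zero]

/-- The bracket relations are solved for the highest term: `[A n, B 0]` yields `ψ (n + 1)`, and
brackets with `ψ 1` raise the index of `A` and `B`. -/
theorem basis_mem_range [CharZero F] (n : ℕ) : basisA F n ∈ (onsagerToLoop F).range ∧
    basisB F n ∈ (onsagerToLoop F).range ∧ basisψ F (n + 1) ∈ (onsagerToLoop F).range := by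
  have hA0 : basisA F 0 ∈ (onsagerToLoop F).range := ⟨_, basisA_zero.symm⟩
  have hB0 : basisB F 0 ∈ (onsagerToLoop F).range := ⟨_, basisB_zero.symm⟩
  have h2 : ∀ {u : Loop F}, (2 : F) • u ∈ (onsagerToLoop F).range →
      u ∈ (onsagerToLoop F).range := fun {u} h =>
    ((onsagerToLoop F).range.toSubmodule.smul_mem_iff (two_ne_zero (α := F))).1 h
  have hψ : ∀ n, basisA F n ∈ (onsagerToLoop F).range → basisB F n ∈ (onsagerToLoop F).range →
      basisψ F (n + 1) ∈ (onsagerToLoop F).range := by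
    intro n hA hB
    have h := (basis_brackets (F := F) n 0).2.2.2.2.2
    rw [add_zero] at h
    have e : (2 : F) • (2 : F) • basisψ F (n + 1) =
        (2 : F) • basisA F n + (2 : F) • basisB F n - ⁅basisA F n, basisB F 0⁆ := by
      rw [h]; module
    apply h2
    apply h2
    rw [e]
    exact sub_mem (add_mem (LieSubalgebra.smul_mem _ _ hA) (LieSubalgebra.smul_mem _ _ hB))
      (LieSubalgebra.lie_mem _ hA hB0)
  induction n with
  | zero => exact ⟨hA0, hB0, hψ 0 hA0 hB0⟩
  | succ n ih =>
    have hψ1 := hψ 0 hA0 hB0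
    have hA : basisA F (n + 1) ∈ (onsagerToLoop F).range := by
      apply h2
      have h := (basis_brackets (F := F) 1 n).2.2.2.1
      rw [add_comm 1 n] at h
      rw [← add_sub_cancel_left ((2 : F) • basisψ F (n + 1)) ((2 : F) • basisA F (n + 1)), ← h]
      exact sub_mem (LieSubalgebra.lie_mem _ hψ1 ih.1) (LieSubalgebra.smul_mem _ _ ih.2.2)
    have hB : basisB F (n + 1) ∈ (onsagerToLoop F).range := by
      apply h2
      have h := (basis_brackets (F := F) n 1).2.2.2.2.1
      rw [← add_sub_cancel_right ((2 : F) • basisB F (n + 1)) ((2 : F) • basisψ F (n + 1)), ← h]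
      exact sub_mem (LieSubalgebra.lie_mem _ ih.2.1 hψ1) (LieSubalgebra.smul_mem _ _ ih.2.2)
    exact ⟨hA, hB, hψ _ hA hB⟩

theorem linearIndependent_basis [CharZero F] :
    LinearIndependent F (family (basisA F) (basisB F) fun i => basisψ F (i + 1)) := by
  have hm : LinearIndependent (Laurent F)
      ![vec (-1) 0 0, vec 0 (-t F) (-(t F - 1)), vec (-1) (-t F) 0] := by
    apply linearIndependent_triple
    intro a b c h
    simp only [smul_vec', vec_add] at h
    obtain ⟨h1, h2, h3⟩ := vec_eq_zero h
    have hb : (t F - 1) * b = 0 := by linear_combination -h3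
    rw [isUnit_t_sub_one.mul_right_eq_zero] at hb
    subst hb
    have hc : t F * c = 0 := by linear_combination -h2
    rw [isUnit_t.mul_right_eq_zero] at hc
    subst hc
    exact ⟨by linear_combination -h1, rfl, rfl⟩
  have h := linearIndependent_family (transcendental_t_sub_one (F := F)) hm
  have e : family (basisA F) (basisB F) (fun i => basisψ F (i + 1)) = family
      (fun i => (t F - 1) ^ i • vec (-1) 0 0)
      (fun i => (t F - 1) ^ i • vec 0 (-t F) (-(t F - 1)))
      (fun i => (t F - 1) ^ i • vec (-1) (-t F) 0) := by
    ext1 (i | i | i)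
    · change basisA F i = (t F - 1) ^ i • vec (-1) 0 0
      rw [basisA_eq_vec, smul_vec']
      apply vec_congr <;> simp
    · exact basisB_eq_smul i
    · exact basisψ_succ i
  rw [e]
  exact h

theorem basis_lie_mem : ∀ u ∈ Set.range (family (basisA F) (basisB F) fun i => basisψ F (i + 1)),
    ∀ v ∈ Set.range (family (basisA F) (basisB F) fun i => basisψ F (i + 1)),
      ⁅u, v⁆ ∈ Submodule.span F
        (Set.range (family (basisA F) (basisB F) fun i => basisψ F (i + 1))) := by
  have hA := mem_span_family_A (F := F) (basisA F) (basisB F) fun i => basisψ F (i + 1)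
  have hB := mem_span_family_B (F := F) (basisA F) (basisB F) fun i => basisψ F (i + 1)
  have hψ := mem_span_family_G (F := F) (basisA F) (basisB F) fun i => basisψ F (i + 1)
  apply lie_mem_span_family
  · intro i j; rw [(basis_brackets i j).1]; exact zero_mem _
  · intro i j; rw [(basis_brackets i j).2.1]; exact zero_mem _
  · intro i j; rw [(basis_brackets _ _).2.2.1]; exact zero_mem _
  · intro i j
    rw [(basis_brackets i j).2.2.2.2.2]
    exact sub_mem (add_mem (Submodule.smul_mem _ _ (hA _)) (Submodule.smul_mem _ _ (hB _)))
      (Submodule.smul_mem _ _ (hψ _))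
  · intro i j
    rw [← lie_skew, (basis_brackets _ i).2.2.2.1, Nat.add_right_comm]
    exact neg_mem (add_mem (Submodule.smul_mem _ _ (hψ _)) (Submodule.smul_mem _ _ (hA _)))
  · intro i j
    rw [(basis_brackets i _).2.2.2.2.1]
    exact add_mem (Submodule.smul_mem _ _ (hB _)) (Submodule.smul_mem _ _ (hψ (i + j)))

theorem exists_onsagerBasis [CharZero F] : ∃ b : Module.Basis (ℕ ⊕ ℕ ⊕ ℕ) F (Onsager F),
    ∀ k, onsagerToLoop F (b k) = family (basisA F) (basisB F) (fun i => basisψ F (i + 1)) k := by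
  have hex : ∀ k, ∃ ξ : Onsager F, onsagerToLoop F ξ =
      family (basisA F) (basisB F) (fun i => basisψ F (i + 1)) k := by
    rintro (i | i | i)
    exacts [(basis_mem_range i).1, (basis_mem_range i).2.1, (basis_mem_range i).2.2]
  choose v hv using hex
  have hcomp : (onsagerToLoop F : Onsager F →ₗ[F] Loop F) ∘ v =
      family (basisA F) (basisB F) (fun i => basisψ F (i + 1)) := funext hv
  have hli : LinearIndependent F v := by
    apply LinearIndependent.of_comp (onsagerToLoop F : Onsager F →ₗ[F] Loop F)
    rw [hcomp]
    exact linearIndependent_basis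
  have hspan : ⊤ ≤ Submodule.span F (Set.range v) := by
    intro ξ _
    -- The span of the family is a subalgebra that contains the images of both generators, hence the
    -- image of `O`; injectivity carries this back to `O`.
    have hξ : onsagerToLoop F ξ ∈ Submodule.span F
        (Set.range (family (basisA F) (basisB F) fun i => basisψ F (i + 1))) := by
      refine Onsager.map_mem _ (spanLieSubalgebra _ basis_lie_mem) ?_ ?_ ξ
      · rw [← neg_neg (genA F), map_neg, ← basisA_zero]
        exact neg_mem (mem_span_family_A _ _ _ 0)
      · rw [← neg_neg (genB F), map_neg, ← basisB_zero]
        exact neg_mem (mem_span_family_B _ _ _ 0)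
    rw [← hcomp, Set.range_comp, ← Submodule.map_span] at hξ
    obtain ⟨η, hη, h⟩ := hξ
    rwa [← onsagerToLoop_injective h]
  exact ⟨Module.Basis.mk hli hspan, fun k => by rw [Module.Basis.mk_apply, hv]⟩

/-! ### Like elements -/

theorem xGen_symm {i j : Fin 4} (hij : i ≠ j) : xGen F hij.symm = -xGen F hij := by
  have h := Presented.rel (TetRel.skew (F := F) hij)
  simp only [map_add, FreeLieAlgebra.lift_of_apply] at h
  exact eq_neg_of_add_eq_zero_right h

theorem xGen_triangle {i j k : Fin 4} (hij : i ≠ j) (hjk : j ≠ k) (hik : i ≠ k) :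
    ⁅xGen F hij, xGen F hjk⁆ = (2 : F) • xGen F hij + (2 : F) • xGen F hjk := by
  have h := Presented.rel (TetRel.triangle (F := F) hij hjk hik)
  simp only [map_add, map_sub, map_smul, LieHom.map_lie, FreeLieAlgebra.lift_of_apply] at h
  exact sub_eq_zero.1 h

/-- Of the two conditions of the second kind for an `x_ij`-like element, one is enough. -/
theorem isLike_of {i j h k : Fin 4} (hij : i ≠ j) (hkh : k ≠ h) (hi : h ≠ i) (hj : h ≠ j)
    (ki : k ≠ i) (kj : k ≠ j) {ξ : Tet F} (h1 : ⁅xGen F hij, ξ⁆ = 0)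
    (h2 : ⁅xGen F hkh, ⁅xGen F hkh, ⁅xGen F hkh, ξ⁆⁆⁆ = (4 : F) • ⁅xGen F hkh, ξ⁆) :
    IsLike hij ξ := by
  refine ⟨h1, fun h' k' hkh' hi' hj' ki' kj' => ?_⟩
  have hcase : (h' = h ∧ k' = k) ∨ (h' = k ∧ k' = h) := by
    omega
  rcases hcase with ⟨rfl, rfl⟩ | ⟨rfl, rfl⟩
  · exact h2
  · rw [xGen_symm hkh]
    simp only [neg_lie, lie_neg, h2, smul_neg, neg_neg]

/-- Up to sign, `x_21` and `x_03` are images of the generators of `O`. Both conditions are therefore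
identities in `O`, and injectivity of `ι` reduces them to the loop algebra. The same holds for
`basisB`. -/
theorem isLike_of_basisA [CharZero F] {ξ : Onsager F} {i : ℕ}
    (h : onsagerToLoop F ξ = basisA F i) :
    IsLike (show (2 : Fin 4) ≠ 1 by decide) (onsagerToTet F ξ) := by
  apply isLike_of (h := 3) (k := 0) _ (by decide) (by decide) (by decide) (by decide) (by decide)
  · have e : ⁅-genA F, ξ⁆ = 0 := by
      apply onsagerToLoop_injective
      rw [LieHom.map_lie, h, ← basisA_zero, (basis_brackets 0 i).1, map_zero]
    have e' := congrArg (onsagerToTet F) e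
    rwa [LieHom.map_lie, map_neg, onsagerToTet_genA, map_zero, ← xGen_symm] at e'
  · rw [← onsagerToTet_genB]
    simp only [← LieHom.map_lie, ← map_smul]
    congr 1
    apply onsagerToLoop_injective
    simp only [LieHom.map_lie, map_smul, h, onsagerToLoop_genB, basisA_eq_vec, lie_vec, smul_vec,
      map_ofNat]
    apply vec_congr <;> ring

theorem isLike_of_basisB [CharZero F] {ξ : Onsager F} {i : ℕ}
    (h : onsagerToLoop F ξ = basisB F i) :
    IsLike (show (3 : Fin 4) ≠ 0 by decide) (onsagerToTet F ξ) := by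
  apply isLike_of (h := 2) (k := 1) _ (by decide) (by decide) (by decide) (by decide) (by decide)
  · have e : ⁅-genB F, ξ⁆ = 0 := by
      apply onsagerToLoop_injective
      rw [LieHom.map_lie, h, ← basisB_zero, (basis_brackets 0 i).2.1, map_zero]
    have e' := congrArg (onsagerToTet F) e
    rwa [LieHom.map_lie, map_neg, onsagerToTet_genB, map_zero, ← xGen_symm] at e'
  · rw [← onsagerToTet_genA]
    simp only [← LieHom.map_lie, ← map_smul]
    congr 1
    apply onsagerToLoop_injective
    simp only [LieHom.map_lie, map_smul, h, onsagerToLoop_genA, basisB_eq_smul, smul_vec', lie_vec,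
      smul_vec, map_ofNat]
    apply vec_congr <;> ring

/-! ### Weights of `ad H`, and the recursion for `ψ` -/

section Weights

variable {L : Type*} [LieRing L] [LieAlgebra F L]

/-- In the expansion by weights, the lower terms of the triple bracket add up to exactly `4 [a - H,
b - H]`, so the leading term vanishes. The scalar `0` keeps the Dolan-Grady form with `c = 0`. -/
theorem serre_of_dolanGrady {a b H : L} (ha : ⁅H, a⁆ = (2 : F) • a) (hb : ⁅H, b⁆ = -((2 : F) • b))
    (hdg : ⁅a - H, ⁅a - H, ⁅a - H, b - H⁆⁆⁆ = (4 : F) • ⁅a - H, b - H⁆) :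
    ⁅a, ⁅a, ⁅a, b⁆⁆⁆ = (0 : F) • ⁅a, b⁆ := by
  have ha' : ⁅a, H⁆ = -((2 : F) • a) := by rw [← lie_skew, ha]
  have h1 : ⁅H, ⁅a, b⁆⁆ = 0 := by
    rw [leibniz_lie, ha, hb, smul_lie, lie_neg, lie_smul, add_neg_cancel]
  have h2 : ⁅H, ⁅a, ⁅a, b⁆⁆⁆ = (2 : F) • ⁅a, ⁅a, b⁆⁆ := by
    rw [leibniz_lie, ha, h1, smul_lie, lie_zero, add_zero]
  have e1 : ⁅a - H, b - H⁆ = ⁅a, b⁆ + (2 : F) • a + (2 : F) • b := by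
    rw [sub_lie, lie_sub, lie_sub, ha', hb, lie_self]; module
  have e2 : ⁅a - H, ⁅a - H, b - H⁆⁆ =
      ⁅a, ⁅a, b⁆⁆ + (2 : F) • ⁅a, b⁆ - (4 : F) • a + (4 : F) • b := by
    rw [e1, sub_lie]
    simp only [lie_add, lie_smul, lie_self, h1, ha, hb]
    module
  have e3 : ⁅a - H, ⁅a - H, ⁅a - H, b - H⁆⁆⁆ =
      ⁅a, ⁅a, ⁅a, b⁆⁆⁆ + (4 : F) • ⁅a - H, b - H⁆ := by
    rw [e2, e1, sub_lie]
    simp only [lie_add, lie_sub, lie_smul, lie_self, h1, h2, ha, hb]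
    module
  rw [e3] at hdg
  rw [zero_smul]
  simpa using hdg

/-- `G 0 = [A 0, B 0]` has weight `0`, and for `c = 0` the recursion is just the bracket with `G 0`
up to sign, which preserves weights. -/
theorem CurrentRelations.weights {A B G : ℕ → L} {H : L} (hr : CurrentRelations (0 : F) A B G)
    (ha : ⁅H, A 0⁆ = (2 : F) • A 0) (hb : ⁅H, B 0⁆ = -((2 : F) • B 0)) (n : ℕ) :
    ⁅H, A n⁆ = (2 : F) • A n ∧ ⁅H, B n⁆ = -((2 : F) • B n) ∧ ⁅H, G n⁆ = 0 := by
  have hG : ∀ n, G n = ⁅A 0, B n⁆ := fun n => by rw [hr.lie_A_B, zero_add]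
  have hA : ∀ n, A (n + 1) = -⁅A n, G 0⁆ := fun n => by rw [hr.lie_A_G]; simp
  have hB : ∀ n, B (n + 1) = ⁅B n, G 0⁆ := fun n => by rw [hr.lie_B_G]; simp
  have hHG : ∀ n, ⁅H, B n⁆ = -((2 : F) • B n) → ⁅H, G n⁆ = 0 := by
    intro n h
    rw [hG, leibniz_lie, ha, h, smul_lie, lie_neg, lie_smul, add_neg_cancel]
  have h0 := hHG 0 hb
  induction n with
  | zero => exact ⟨ha, hb, h0⟩
  | succ n ih =>
    have hB' : ⁅H, B (n + 1)⁆ = -((2 : F) • B (n + 1)) := by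
      rw [hB, leibniz_lie, ih.2.1, h0, lie_zero, add_zero, neg_lie, smul_lie]
    refine ⟨?_, hB', hHG _ hB'⟩
    rw [hA, lie_neg, leibniz_lie, ih.1, h0, lie_zero, add_zero, smul_lie, smul_neg]

/-- If `a - H` and `b - H` satisfy the Dolan-Grady relations, where `a` and `b` have weights `2`
and `-2` with respect to `H`, then `ad H` has the eigenvalues `0`, `2`, `-2` on the subalgebra that
is generated by `a - H` and `b - H`. -/
theorem lie_cube_of_weights [CharZero F] {H : L} (φ : Onsager F →ₗ⁅F⁆ L)
    (ha : ⁅H, φ (genA F)⁆ = (2 : F) • (φ (genA F) + H))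
    (hb : ⁅H, φ (genB F)⁆ = -((2 : F) • (φ (genB F) + H))) (ξ : Onsager F) :
    ⁅H, ⁅H, ⁅H, φ ξ⁆⁆⁆ = (4 : F) • ⁅H, φ ξ⁆ := by
  have ha' : ⁅H, φ (genA F) + H⁆ = (2 : F) • (φ (genA F) + H) := by
    rw [lie_add, lie_self, add_zero, ha]
  have hb' : ⁅H, φ (genB F) + H⁆ = -((2 : F) • (φ (genB F) + H)) := by
    rw [lie_add, lie_self, add_zero, hb]
  have hdgA := congrArg φ (genA_dolanGrady F)
  have hdgB := congrArg φ (genB_dolanGrady F)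
  simp only [LieHom.map_lie, map_smul] at hdgA hdgB
  have sA := serre_of_dolanGrady ha' hb' (by simpa only [add_sub_cancel_right] using hdgA)
  -- With the two generators exchanged, negating all three elements makes the first weight `2`
  -- again.
  have sB := serre_of_dolanGrady (F := F) (a := -(φ (genB F) + H)) (b := -(φ (genA F) + H)) (H := -H)
    (by rw [lie_neg, neg_lie, neg_neg, hb', smul_neg])
    (by rw [lie_neg, neg_lie, neg_neg, ha', smul_neg, neg_neg])
    (by
      have e : ∀ u : L, -(u + H) - -H = -u := fun u => by abel
      simpa only [e, neg_lie, lie_neg, neg_neg] using hdgB)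
  simp only [neg_lie, lie_neg, neg_neg] at sB
  obtain ⟨A, B, G, hA0, hB0, hr⟩ := exists_currentRelations sA sB
  have hw := hr.weights (H := H) (by rw [hA0, ha']) (by rw [hB0, hb'])
  -- `H` need not lie in the image of `φ`; it is adjoined because the generators map to `A 0 - H`
  -- and `B 0 - H`.
  have hHmem : H ∈ Submodule.span F (insert H (Set.range (family A B G))) :=
    Submodule.subset_span (Set.mem_insert _ _)
  have hle : Submodule.span F (Set.range (family A B G)) ≤
      Submodule.span F (insert H (Set.range (family A B G))) :=
    Submodule.span_mono (Set.subset_insert _ _)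
  have hHlie : ∀ k, ∃ r : F, (r = 0 ∨ r = 2 ∨ r = -2) ∧
      ⁅H, family A B G k⁆ = r • family A B G k := by
    rintro (n | n | n)
    · exact ⟨2, by simp, (hw n).1⟩
    · exact ⟨-2, by simp, by rw [neg_smul]; exact (hw n).2.1⟩
    · exact ⟨0, by simp, by rw [zero_smul]; exact (hw n).2.2⟩
  have hH : ∀ u ∈ Set.range (family A B G),
      ⁅H, u⁆ ∈ Submodule.span F (insert H (Set.range (family A B G))) := by
    rintro _ ⟨k, rfl⟩
    obtain ⟨r, -, h⟩ := hHlie k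
    rw [h]
    exact Submodule.smul_mem _ _ (hle (Submodule.subset_span ⟨k, rfl⟩))
  have hs : ∀ u ∈ insert H (Set.range (family A B G)), ∀ v ∈ insert H (Set.range (family A B G)),
      ⁅u, v⁆ ∈ Submodule.span F (insert H (Set.range (family A B G))) := by
    rintro u (rfl | hu) v (rfl | hv)
    · rw [lie_self]; exact zero_mem _
    · exact hH v hv
    · rw [← lie_skew]; exact neg_mem (hH u hu)
    · exact hle (hr.lie_mem u hu v hv)
  have hmem : φ ξ ∈ Submodule.span F (insert H (Set.range (family A B G))) := by
    refine Onsager.map_mem φ (spanLieSubalgebra _ hs) ?_ ?_ ξ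
    · rw [← add_sub_cancel_right (φ (genA F)) H, ← hA0]
      exact sub_mem (hle (mem_span_family_A A B G 0)) hHmem
    · rw [← add_sub_cancel_right (φ (genB F)) H, ← hB0]
      exact sub_mem (hle (mem_span_family_B A B G 0)) hHmem
  generalize φ ξ = v at hmem
  induction hmem using Submodule.span_induction with
  | mem u hu =>
    rcases hu with rfl | ⟨k, rfl⟩
    · simp
    · obtain ⟨r, hr, h⟩ := hHlie k
      simp only [h, lie_smul, smul_smul]
      congr 1
      rcases hr with rfl | rfl | rfl <;> norm_num
  | zero => simp
  | add u v _ _ h1 h2 => simp only [lie_add, h1, h2, smul_add]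
  | smul r u _ h => rw [lie_smul, lie_smul, lie_smul, h, smul_comm]

/-- The recursion for the elements `ψ n` shows that they commute with `ψ 0`. -/
theorem lie_psi_zero [CharZero F] {a b ψ : ℕ → L}
    (hab : ∀ n, ⁅a n, b 0⁆ = (2 : F) • a n + (2 : F) • b n - (4 : F) • ψ (n + 1))
    (hψa : ∀ n, ⁅ψ 1, a n⁆ = (2 : F) • ψ (n + 1) + (2 : F) • a (n + 1))
    (hbψ : ∀ n, ⁅b n, ψ 1⁆ = (2 : F) • b (n + 1) + (2 : F) • ψ (n + 1))
    (hψψ : ∀ n, ⁅ψ 1, ψ (n + 1)⁆ = 0)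
    (hb0 : ∀ n, ⁅b 0, ψ n⁆ = (2 : F) • b n + (2 : F) • ψ n)
    (ha0 : ⁅ψ 0, a 0⁆ = (2 : F) • ψ 0 + (2 : F) • a 0) (n : ℕ) : ⁅ψ 0, ψ n⁆ = 0 := by
  have h0b : ⁅ψ 0, b 0⁆ = -((2 : F) • b 0 + (2 : F) • ψ 0) := by rw [← lie_skew, hb0]
  -- `ad (ψ 0)` is applied to `hab n`; everything except `4 [ψ 0, ψ (n + 1)]` cancels.
  have step : ∀ n, ⁅ψ 0, a n⁆ = (2 : F) • ψ n + (2 : F) • a n →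
      ⁅ψ 0, b n⁆ = -((2 : F) • b n + (2 : F) • ψ n) → ⁅ψ 0, ψ (n + 1)⁆ = 0 := by
    intro n h1 h2
    have e := congrArg (fun u => ⁅ψ 0, u⁆) (hab n)
    have h3 : ⁅a n, ψ 0⁆ = -((2 : F) • ψ n + (2 : F) • a n) := by rw [← lie_skew, h1]
    have h4 : ⁅ψ n, b 0⁆ = -((2 : F) • b n + (2 : F) • ψ n) := by rw [← lie_skew, hb0]
    simp only [leibniz_lie (ψ 0) (a n), h1, h0b, add_lie, lie_add, lie_sub, lie_neg, smul_lie,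
      lie_smul, h2, h3, h4] at e
    have : (4 : F) • ⁅ψ 0, ψ (n + 1)⁆ = 0 := by
      have e' := sub_eq_zero.2 e
      rw [← e']
      module
    exact (smul_eq_zero_iff_right (by norm_num : (4 : F) ≠ 0)).1 this
  have key : ∀ n, ⁅ψ 0, a n⁆ = (2 : F) • ψ n + (2 : F) • a n ∧
      ⁅ψ 0, b n⁆ = -((2 : F) • b n + (2 : F) • ψ n) ∧ ⁅ψ 0, ψ n⁆ = 0 := by
    have h01 := step 0 ha0 h0b
    have h10 : ⁅ψ 1, ψ 0⁆ = 0 := by rw [← lie_skew, h01, neg_zero]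
    intro n
    induction n with
    | zero => exact ⟨ha0, h0b, lie_self _⟩
    | succ n ih =>
      obtain ⟨h1, h2, h3⟩ := ih
      have h4 := step n h1 h2
      have h1n : ⁅ψ 1, ψ n⁆ = 0 := by
        cases n with
        | zero => exact h10
        | succ n => exact hψψ n
      have hn1 : ⁅ψ n, ψ 1⁆ = 0 := by rw [← lie_skew, h1n, neg_zero]
      refine ⟨?_, ?_, h4⟩
      -- Since `[ψ 0, ψ 1] = 0`, the operators `ad (ψ 0)` and `ad (ψ 1)` commute, and `ad (ψ 1)`
      -- carries the relation for `a n` to the one for `a (n + 1)`. The same works for `b`.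
      · have e := leibniz_lie (ψ 0) (ψ 1) (a n)
        rw [h01, zero_lie, zero_add, h1, hψa] at e
        simp only [lie_add, lie_smul, h1n, hψa, h4] at e
        apply smul_right_injective L (two_ne_zero (α := F))
        simp only
        rw [← sub_eq_zero, ← sub_eq_zero.2 e]
        module
      · have e := leibniz_lie (ψ 0) (b n) (ψ 1)
        rw [h01, lie_zero, add_zero, h2, hbψ] at e
        simp only [lie_add, lie_smul, neg_lie, add_lie, smul_lie, hn1, hbψ, h4] at e
        apply smul_right_injective L (two_ne_zero (α := F))
        simp only
        rw [← sub_eq_zero, ← sub_eq_zero.2 e]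
        module
  exact (key n).2.2

end Weights

theorem isLike_of_basisψ [CharZero F] {A B P : ℕ → Onsager F}
    (hA : ∀ i, onsagerToLoop F (A i) = basisA F i) (hB : ∀ i, onsagerToLoop F (B i) = basisB F i)
    (hP : ∀ i, onsagerToLoop F (P i) = basisψ F (i + 1)) (i : ℕ) :
    IsLike (show (0 : Fin 4) ≠ 2 by decide) (onsagerToTet F (P i)) := by
  have hA0 : A 0 = -genA F := onsagerToLoop_injective (by rw [hA, basisA_zero])
  have hB0 : B 0 = -genB F := onsagerToLoop_injective (by rw [hB, basisB_zero])
  have h21 : onsagerToTet F (A 0) = xGen F (show (2 : Fin 4) ≠ 1 by decide) := by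
    rw [hA0, map_neg, onsagerToTet_genA, ← xGen_symm]
  have h30 : onsagerToTet F (B 0) = xGen F (show (3 : Fin 4) ≠ 0 by decide) := by
    rw [hB0, map_neg, onsagerToTet_genB, ← xGen_symm]
  apply isLike_of (h := 1) (k := 3) _ (by decide) (by decide) (by decide) (by decide) (by decide)
  -- `x_02` takes the place of `ψ 0`, its image under `σ` being `basisψ F 0`; hence `P n` gets the
  -- index `n + 1`. The relations of `x_02` with `x_30` and `x_21` are triangle relations of `⊠`,
  -- and all others hold in `O`.
  · obtain ⟨ψ, hψ0, hψs⟩ : ∃ ψ : ℕ → Tet F, ψ 0 = xGen F (show (0 : Fin 4) ≠ 2 by decide) ∧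
        ∀ n, ψ (n + 1) = onsagerToTet F (P n) :=
      ⟨fun n => Nat.casesOn n (xGen F (show (0 : Fin 4) ≠ 2 by decide))
        fun m => onsagerToTet F (P m), rfl, fun _ => rfl⟩
    have hψ1 : ψ 1 = onsagerToTet F (P 0) := hψs 0
    rw [← hψ0, ← hψs]
    refine lie_psi_zero (F := F) (a := fun n => onsagerToTet F (A n))
      (b := fun n => onsagerToTet F (B n)) ?_ ?_ ?_ ?_ ?_ ?_ (i + 1)
    · intro n
      simp only [hψs, ← LieHom.map_lie, ← map_smul, ← map_add, ← map_sub]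
      congr 1
      apply onsagerToLoop_injective
      simp only [LieHom.map_lie, map_smul, map_add, map_sub, hA, hB, hP]
      exact (basis_brackets n 0).2.2.2.2.2
    · intro n
      simp only [hψ1, hψs, ← LieHom.map_lie, ← map_smul, ← map_add]
      congr 1
      apply onsagerToLoop_injective
      simp only [LieHom.map_lie, map_smul, map_add, hA, hP]
      rw [(basis_brackets _ _).2.2.2.1, add_comm (0 + 1) n]
    · intro n
      simp only [hψ1, hψs, ← LieHom.map_lie, ← map_smul, ← map_add]
      congr 1
      apply onsagerToLoop_injective
      simp only [LieHom.map_lie, map_smul, map_add, hB, hP]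
      exact (basis_brackets _ _).2.2.2.2.1
    · intro n
      simp only [hψ1, hψs, ← LieHom.map_lie]
      rw [← map_zero (onsagerToTet F)]
      congr 1
      apply onsagerToLoop_injective
      simp only [LieHom.map_lie, map_zero, hP]
      exact (basis_brackets _ _).2.2.1
    · rintro (_ | n)
      · simp only [h30, hψ0]
        exact xGen_triangle _ _ (by decide)
      · simp only [hψs, ← LieHom.map_lie, ← map_smul, ← map_add]
        congr 1
        apply onsagerToLoop_injective
        simp only [LieHom.map_lie, map_smul, map_add, hB, hP]
        rw [(basis_brackets _ _).2.2.2.2.1, zero_add]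
    · simp only [h21, hψ0]
      exact xGen_triangle _ _ (by decide)
  -- Here `H` is `x_31`, and the two weight conditions are the triangle relations for `x_31, x_12`
  -- and `x_03, x_31`.
  · apply lie_cube_of_weights
    · rw [onsagerToTet_genA, xGen_triangle _ _ (by decide), ← smul_add, add_comm]
    · rw [onsagerToTet_genB, ← lie_skew, xGen_triangle _ _ (by decide), ← smul_add]

end OnsagerTet

end

theorem mainTheorem4 (F : Type*) [Field F] [CharZero F] :
    -- `O` is identified with its image in the loop algebra
    Function.Injective (OnsagerTet.onsagerToLoop F) ∧
    -- the basis of `O`, indexed by three copies of `ℕ`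
    (∃ b : Module.Basis (ℕ ⊕ ℕ ⊕ ℕ) F (OnsagerTet.Onsager F),
      (∀ i : ℕ, OnsagerTet.onsagerToLoop F (b (Sum.inl i)) = OnsagerTet.basisA F i) ∧
      (∀ i : ℕ, OnsagerTet.onsagerToLoop F (b (Sum.inr (Sum.inl i))) = OnsagerTet.basisB F i) ∧
      (∀ i : ℕ, OnsagerTet.onsagerToLoop F (b (Sum.inr (Sum.inr i))) = OnsagerTet.basisψ F (i + 1)) ∧
      b (Sum.inl 0) = -OnsagerTet.genA F ∧
      b (Sum.inr (Sum.inl 0)) = -OnsagerTet.genB F ∧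
      -- inside `⊠`, the basis elements are `x_21`-like, `x_30`-like and `x_02`-like, respectively
      (∀ i : ℕ, OnsagerTet.IsLike (show (2 : Fin 4) ≠ 1 by decide)
        (OnsagerTet.onsagerToTet F (b (Sum.inl i)))) ∧
      (∀ i : ℕ, OnsagerTet.IsLike (show (3 : Fin 4) ≠ 0 by decide)
        (OnsagerTet.onsagerToTet F (b (Sum.inr (Sum.inl i))))) ∧
      (∀ i : ℕ, OnsagerTet.IsLike (show (0 : Fin 4) ≠ 2 by decide)
        (OnsagerTet.onsagerToTet F (b (Sum.inr (Sum.inr i)))))) ∧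
    -- the bracket relations
    (∀ i j : ℕ,
      ⁅OnsagerTet.basisA F i, OnsagerTet.basisA F j⁆ = 0 ∧
      ⁅OnsagerTet.basisB F i, OnsagerTet.basisB F j⁆ = 0 ∧
      ⁅OnsagerTet.basisψ F i, OnsagerTet.basisψ F j⁆ = 0 ∧
      ⁅OnsagerTet.basisψ F i, OnsagerTet.basisA F j⁆
        = (2 : F) • OnsagerTet.basisψ F (i + j) + (2 : F) • OnsagerTet.basisA F (i + j) ∧
      ⁅OnsagerTet.basisB F i, OnsagerTet.basisψ F j⁆
        = (2 : F) • OnsagerTet.basisB F (i + j) + (2 : F) • OnsagerTet.basisψ F (i + j) ∧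
      ⁅OnsagerTet.basisA F i, OnsagerTet.basisB F j⁆
        = (2 : F) • OnsagerTet.basisA F (i + j) + (2 : F) • OnsagerTet.basisB F (i + j)
          - (4 : F) • OnsagerTet.basisψ F (i + j + 1)) := by

  obtain ⟨b, hb⟩ := OnsagerTet.exists_onsagerBasis (F := F)
  have hA : ∀ i, OnsagerTet.onsagerToLoop F (b (Sum.inl i)) = OnsagerTet.basisA F i :=
    fun i => hb (Sum.inl i)
  have hB : ∀ i, OnsagerTet.onsagerToLoop F (b (Sum.inr (Sum.inl i))) = OnsagerTet.basisB F i :=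
    fun i => hb (Sum.inr (Sum.inl i))
  have hψ : ∀ i, OnsagerTet.onsagerToLoop F (b (Sum.inr (Sum.inr i))) =
      OnsagerTet.basisψ F (i + 1) := fun i => hb (Sum.inr (Sum.inr i))
  have hinj := OnsagerTet.onsagerToLoop_injective (F := F)
  exact ⟨hinj, ⟨b, hA, hB, hψ,
    hinj (by rw [hA, OnsagerTet.basisA_zero]), hinj (by rw [hB, OnsagerTet.basisB_zero]),
    fun i => OnsagerTet.isLike_of_basisA (hA i), fun i => OnsagerTet.isLike_of_basisB (hB i),
    OnsagerTet.isLike_of_basisψ hA hB hψ⟩, OnsagerTet.basis_brackets⟩
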